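/- Let $n\in\mathbb N$, $0<\alpha<\infty$ and $1<s\le n/\alpha$. Let $G_\alpha$ be the Bessel kernel on $\mathbb R^n$, that is, the integrable function with $\int_{\mathbb R^n}G_\alpha(x)e^{-ix\cdot\xi}\,dx=(1+|\xi|^2)^{-\alpha/2}$, and let $$\mathcal C(E)=\inf\{\|f\|_{L^s(\mathbb R^n)}^s: f\ge 0,\ G_\alpha*f\ge 1\text{ on }E\},\qquad E\subseteq\mathbb R^n,$$ be the Bessel capacity. For $0<q<\infty$ and a real function $f$ on $\mathbb R^n$ put $$\|f\|_{L^{1,q}(\mathcal C)}=\Big(\int_0^\infty \mathcal C(\{|f|>t\})^q\,t^q\,\frac{dt}{t}\Big)^{1/q},$$ let $L^{1,q}(\mathcal C)$ be the space of functions $f$ for which this is finite, let $C_0$ be the space of compactly supported continuous real functions on $\mathbb R^n$, and let $\mathcal L^{1,q}(\mathcal C)$ be the closure of $C_0$ in $L^{1,q}(\mathcal C)$ with respect to the quasi-norm $\|\cdot\|_{L^{1,q}(\mathcal C)}$. Let $\mathcal L^{1,q}(\mathcal C)^*$ be the space of continuous linear functionals $L$ on $\mathcal L^{1,q}(\mathcal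 C)$, with $\|L\|=\sup\{|L(f)|:\|f\|_{L^{1,q}(\mathcal C)}\le 1\}$. A measure $\mu$ on $\mathbb R^n$ is a real linear functional on $C_0$ that is continuous for the inductive limit topology; $|\mu|$ is its total variation and $|\mu|^*$ the outer measure of $|\mu|$, so that $|\mu|^*(E)=\inf\{|\mu|(G):G\supseteq E\text{ open}\}$. Put $$\|\mu\|_{\mathfrak M}=\sup_K\frac{|\mu|(K)}{\mathcal C(K)}\in[0,\infty],$$ where the supremum is over all compact $K\subseteq\mathbb R^n$ with $\mathcal C(K)\ne 0$, and let $\mathfrak M$ be the space of all measures $\mu$ with $\|\mu\|_{\mathfrak M}<\infty$. **Theorem.** Let $0<q\le 1$. Then $\mathcal L^{1,q}(\mathcal C)^*\approx\mathfrak M$. That is: for every $\mu\in\mathfrak M$, every $f\in\mathcal L^{1,q}(\mathcal C)$ is $|\mu|$-integrable and $L_\mu(f)=\int_{\mathbb R^n} f\,d\mu$ defines an element $L_\mu$ of $\mathcal L^{1,q}(\mathcal C)^*$; the map $\mu\mapsto L_\mu$ is a linear bijection of $\mathfrak M$ onto $\mathcal L^{1,q}(\mathcal C)^*$; and there is a constant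 $c>0$ such that $c^{-1}\|\mu\|_{\mathfrak M}\le\|L_\mu\|\le c\,\|\mu\|_{\mathfrak M}$ for all $\mu\in\mathfrak M$. Moreover, for every measure $\mu$ on $\mathbb R^n$, $$\|\mu\|_{\mathfrak M}=\inf\{a>0:\ |\mu|^*(E)\le a\,\mathcal C(E)\ \text{ for all } E\subseteq\mathbb R^n\}$$ (with $\inf\emptyset=\infty$). -/

import Mathlib

open MeasureTheory Set
open scoped ENNReal NNReal CompactlySupported

namespace CapacitaryLorentz

/-- The Euclidean space `ℝⁿ`. -/
abbrev Rn (n : ℕ) : Type := EuclideanSpace ℝ (Fin n)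

/-! ### Bessel kernels and Bessel capacities -/

/-- The nonnegative function
`(x, t) ↦ Γ(α/2)⁻¹ t^(α/2-1) e^(-t) (4πt)^(-n/2) e^(-|x|²/(4t))`, for `t > 0`. -/
noncomputable def besselIntegrand {n : ℕ} (α : ℝ) (x : Rn n) (t : ℝ) : ℝ :=
  ((Real.Gamma (α / 2))⁻¹ * (t ^ (α / 2 - 1) * Real.exp (-t))) *
    ((4 * Real.pi * t) ^ (-(n : ℝ) / 2) * Real.exp (-‖x‖ ^ 2 / (4 * t)))

/-- The Bessel kernel `G_α` on `ℝⁿ`, with values in `[0, ∞]`. For `α > 0` it is the inverse Fourier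
transform of `ξ ↦ (1 + |ξ|²)^(-α/2)`: see `lintegral_besselKernel` and `fourier_besselKernel`. -/
noncomputable def besselKernel {n : ℕ} (α : ℝ) (x : Rn n) : ℝ≥0∞ :=
  ∫⁻ t in Ioi (0 : ℝ), ENNReal.ofReal (besselIntegrand α x t)

lemma besselIntegrand_nonneg {n : ℕ} {α : ℝ} (hα : 0 < α) (x : Rn n) {t : ℝ} (ht : 0 < t) :
    0 ≤ besselIntegrand α x t := by
  have := (Real.Gamma_pos_of_pos (half_pos hα)).le
  unfold besselIntegrand
  positivity

lemma measurable_besselIntegrand {n : ℕ} (α : ℝ) :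
    Measurable fun z : Rn n × ℝ => besselIntegrand α z.1 z.2 := by
  unfold besselIntegrand
  fun_prop

/-- The Gaussian factor has Fourier transform `e^(-t|ξ|²)`. -/
lemma integral_besselIntegrand {n : ℕ} (α : ℝ) (ξ : Rn n) {t : ℝ} (ht : 0 < t) :
    ∫ x : Rn n, (besselIntegrand α x t : ℂ) * Complex.exp (-Complex.I * (inner ℝ ξ x : ℝ)) =
      (((Real.Gamma (α / 2))⁻¹ * (t ^ (α / 2 - 1) * Real.exp (-((1 + ‖ξ‖ ^ 2) * t))) : ℝ) : ℂ) := by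
  have hb : 0 < (((4 * t)⁻¹ : ℝ) : ℂ).re := by rw [Complex.ofReal_re]; positivity
  have h := GaussianFourier.integral_cexp_neg_mul_sq_norm_add (V := Rn n) hb (-Complex.I) ξ
  have e : ∀ x : Rn n,
      (besselIntegrand α x t : ℂ) * Complex.exp (-Complex.I * (inner ℝ ξ x : ℝ)) =
      (((Real.Gamma (α / 2))⁻¹ * (t ^ (α / 2 - 1) * Real.exp (-t)) *
        (4 * Real.pi * t) ^ (-(n : ℝ) / 2) : ℝ) : ℂ) *
      Complex.exp (-(((4 * t)⁻¹ : ℝ) : ℂ) * (‖x‖ : ℂ) ^ 2 + -Complex.I * (inner ℝ ξ x : ℝ)) := by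
    intro x
    rw [Complex.exp_add, besselIntegrand]
    have : Complex.exp (-(((4 * t)⁻¹ : ℝ) : ℂ) * (‖x‖ : ℂ) ^ 2) =
        (Real.exp (-‖x‖ ^ 2 / (4 * t)) : ℂ) := by
      push_cast
      congr 1
      ring
    rw [this]
    push_cast
    ring
  simp_rw [e]
  rw [integral_const_mul, h]
  have h1 : ((Real.pi : ℂ) / (((4 * t)⁻¹ : ℝ) : ℂ)) ^ ((Module.finrank ℝ (Rn n) : ℂ) / 2) =
      (((4 * Real.pi * t) ^ ((n : ℝ) / 2) : ℝ) : ℂ) := by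
    rw [finrank_euclideanSpace_fin, Complex.ofReal_cpow (by positivity)]
    congr 1
    · push_cast
      rw [div_inv_eq_mul]
      ring
    · push_cast; ring
  have h2 : Complex.exp ((-Complex.I) ^ 2 * (‖ξ‖ : ℂ) ^ 2 / (4 * (((4 * t)⁻¹ : ℝ) : ℂ))) =
      (Real.exp (-(‖ξ‖ ^ 2 * t)) : ℂ) := by
    have ht' : (t : ℂ) ≠ 0 := by exact_mod_cast ht.ne'
    push_cast
    congr 1
    rw [neg_sq, Complex.I_sq]
    field_simp
  rw [h1, h2, ← Complex.ofReal_mul, ← Complex.ofReal_mul]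
  congr 1
  have h3 : (4 * Real.pi * t) ^ (-(n : ℝ) / 2) * (4 * Real.pi * t) ^ ((n : ℝ) / 2) = 1 := by
    rw [← Real.rpow_add (by positivity), neg_div, neg_add_cancel, Real.rpow_zero]
  have h4 : Real.exp (-((1 + ‖ξ‖ ^ 2) * t)) = Real.exp (-t) * Real.exp (-(‖ξ‖ ^ 2 * t)) := by
    rw [← Real.exp_add]; ring_nf
  rw [h4]
  linear_combination ((Real.Gamma (α / 2))⁻¹ * (t ^ (α / 2 - 1) * Real.exp (-t)) *
    Real.exp (-(‖ξ‖ ^ 2 * t))) * h3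

lemma integral_gamma_factor {α : ℝ} (hα : 0 < α) {r : ℝ} (hr : 0 < r) :
    ∫ t in Ioi (0 : ℝ), (Real.Gamma (α / 2))⁻¹ * (t ^ (α / 2 - 1) * Real.exp (-(r * t))) =
      r ^ (-α / 2) := by
  have h := Real.integral_rpow_mul_exp_neg_mul_Ioi (half_pos hα) hr
  have hG := (Real.Gamma_pos_of_pos (half_pos hα)).ne'
  rw [integral_const_mul, h, one_div, Real.inv_rpow hr.le, ← Real.rpow_neg hr.le, neg_div]
  field_simp

lemma integrable_besselIntegrand_left {n : ℕ} (α : ℝ) {t : ℝ} (ht : 0 < t) :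
    Integrable fun x : Rn n => besselIntegrand α x t := by
  have hb : 0 < (((4 * t)⁻¹ : ℝ) : ℂ).re := by rw [Complex.ofReal_re]; positivity
  have h := (GaussianFourier.integrable_cexp_neg_mul_sq_norm_add (V := Rn n) hb 0 0).re
  have e : ∀ x : Rn n, besselIntegrand α x t =
      (Real.Gamma (α / 2))⁻¹ * (t ^ (α / 2 - 1) * Real.exp (-t)) *
        (4 * Real.pi * t) ^ (-(n : ℝ) / 2) * RCLike.re
        (Complex.exp (-(((4 * t)⁻¹ : ℝ) : ℂ) * (‖x‖ : ℂ) ^ 2 + 0 * (inner ℝ (0 : Rn n) x : ℝ))) := by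
    intro x
    have : Complex.exp (-(((4 * t)⁻¹ : ℝ) : ℂ) * (‖x‖ : ℂ) ^ 2 +
        0 * (inner ℝ (0 : Rn n) x : ℝ)) = (Real.exp (-‖x‖ ^ 2 / (4 * t)) : ℂ) := by
      push_cast
      congr 1
      ring
    rw [this, besselIntegrand]
    simp only [RCLike.re_to_complex, Complex.ofReal_re]
    ring
  simp_rw [e]
  exact h.const_mul _

lemma integrable_besselIntegrand {n : ℕ} {α : ℝ} (hα : 0 < α) :
    Integrable (fun z : Rn n × ℝ => besselIntegrand α z.1 z.2)
      (volume.prod (volume.restrict (Ioi 0))) := by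
  rw [integrable_prod_iff' (measurable_besselIntegrand α).aestronglyMeasurable]
  refine ⟨(ae_restrict_mem measurableSet_Ioi).mono fun t ht =>
    integrable_besselIntegrand_left α ht, ?_⟩
  have e : ∀ t ∈ Ioi (0 : ℝ), ∫ x : Rn n, ‖besselIntegrand α x t‖ =
      (Real.Gamma (α / 2))⁻¹ * (t ^ (α / 2 - 1) * Real.exp (-(1 * t))) := fun t ht => by
    have h := integral_besselIntegrand α (0 : Rn n) ht
    simp only [inner_zero_left, Complex.ofReal_zero, mul_zero, Complex.exp_zero, mul_one,
      norm_zero, ne_eq, OfNat.ofNat_ne_zero, not_false_eq_true, zero_pow, add_zero] at h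
    rw [integral_complex_ofReal, Complex.ofReal_inj] at h
    rw [← h]
    exact integral_congr_ae (.of_forall fun x => by
      simp [abs_of_nonneg (besselIntegrand_nonneg hα x ht)])
  refine (integrableOn_congr_fun e measurableSet_Ioi).2 ?_
  have h := integral_gamma_factor hα one_pos
  by_contra hcon
  rw [integral_undef hcon, Real.one_rpow] at h
  exact zero_ne_one h

lemma toReal_besselKernel {n : ℕ} {α : ℝ} (hα : 0 < α) (x : Rn n) :
    (besselKernel α x).toReal = ∫ t in Ioi (0 : ℝ), besselIntegrand α x t := by
  rw [besselKernel, integral_eq_lintegral_of_nonneg_ae]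
  · exact (ae_restrict_mem measurableSet_Ioi).mono fun t ht => besselIntegrand_nonneg hα x ht
  · exact ((measurable_besselIntegrand α).comp measurable_prodMk_left).aestronglyMeasurable

/-- The Bessel kernel has integral `1`; in particular it is finite almost everywhere. -/
theorem lintegral_besselKernel {n : ℕ} {α : ℝ} (hα : 0 < α) :
    ∫⁻ x : Rn n, besselKernel α x = 1 := by
  unfold besselKernel
  rw [← lintegral_prod (μ := volume) (ν := volume.restrict (Ioi 0))
      (fun z : Rn n × ℝ => ENNReal.ofReal (besselIntegrand α z.1 z.2))
      (measurable_besselIntegrand α).ennreal_ofReal.aemeasurable,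
    ← ofReal_integral_eq_lintegral_ofReal (integrable_besselIntegrand hα),
    integral_prod_symm _ (integrable_besselIntegrand hα)]
  · have e : ∀ t ∈ Ioi (0 : ℝ), ∫ x : Rn n, besselIntegrand α x t =
        (Real.Gamma (α / 2))⁻¹ * (t ^ (α / 2 - 1) * Real.exp (-(1 * t))) := fun t ht => by
      have h := integral_besselIntegrand α (0 : Rn n) ht
      simp only [inner_zero_left, Complex.ofReal_zero, mul_zero, Complex.exp_zero, mul_one,
        norm_zero, ne_eq, OfNat.ofNat_ne_zero, not_false_eq_true, zero_pow, add_zero] at h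
      rwa [integral_complex_ofReal, Complex.ofReal_inj] at h
    rw [setIntegral_congr_fun measurableSet_Ioi e, integral_gamma_factor hα one_pos]
    simp
  · have h : ∀ᵐ z : Rn n × ℝ ∂(volume.prod (volume.restrict (Ioi 0))), z.2 ∈ Ioi (0 : ℝ) :=
      Measure.quasiMeasurePreserving_snd.ae (ae_restrict_mem measurableSet_Ioi)
    exact h.mono fun z hz => besselIntegrand_nonneg hα z.1 hz

/-- The Fourier transform of the Bessel kernel: `∫ G_α(x) e^(-i x·ξ) dx = (1 + |ξ|²)^(-α/2)`. -/
theorem fourier_besselKernel {n : ℕ} {α : ℝ} (hα : 0 < α) (ξ : Rn n) :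
    ∫ x : Rn n, ((besselKernel α x).toReal : ℂ) * Complex.exp (-Complex.I * (inner ℝ ξ x : ℝ)) =
      (((1 + ‖ξ‖ ^ 2) ^ (-α / 2) : ℝ) : ℂ) := by
  have hr : 0 < 1 + ‖ξ‖ ^ 2 := by positivity
  have hint : Integrable (Function.uncurry fun (x : Rn n) (t : ℝ) =>
      (besselIntegrand α x t : ℂ) * Complex.exp (-Complex.I * (inner ℝ ξ x : ℝ)))
      (volume.prod (volume.restrict (Ioi 0))) := by
    refine (integrable_besselIntegrand hα).ofReal.mul_bdd (c := 1) ?_ (.of_forall fun z => ?_)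
    · refine Continuous.aestronglyMeasurable ?_
      fun_prop
    · rw [Complex.norm_exp]
      simp
  simp_rw [toReal_besselKernel hα, ← integral_complex_ofReal, ← integral_mul_const]
  rw [integral_integral_swap hint,
    setIntegral_congr_fun measurableSet_Ioi fun t ht => integral_besselIntegrand α ξ ht,
    integral_complex_ofReal, integral_gamma_factor hα hr]

/-- The Bessel capacity `Cap_{α,s}(E) = inf {‖f‖_{L^s}^s : f ≥ 0, G_α ∗ f ≥ 1 on E}`. -/
noncomputable def capacity {n : ℕ} (α s : ℝ) (E : Set (Rn n)) : ℝ≥0∞ :=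
  ⨅ (f : Rn n → ℝ≥0∞)
    (_ : Measurable f ∧ ∀ x ∈ E, 1 ≤ ∫⁻ y, besselKernel α (x - y) * f y), ∫⁻ y, f y ^ s

lemma capacity_mono {n : ℕ} (α s : ℝ) {A B : Set (Rn n)} (h : A ⊆ B) :
    capacity α s A ≤ capacity α s B :=
  le_iInf₂ fun f hf => iInf₂_le f ⟨hf.1, fun x hx => hf.2 x (h hx)⟩

lemma capacity_union_le {n : ℕ} (α s : ℝ) (A B : Set (Rn n)) :
    capacity α s (A ∪ B) ≤ capacity α s A + capacity α s B := by
  refine ENNReal.le_of_forall_pos_le_add fun ε hε h => ?_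
  have hA : capacity α s A ≠ ∞ := ne_top_of_le_ne_top h.ne le_self_add
  have hB : capacity α s B ≠ ∞ := ne_top_of_le_ne_top h.ne le_add_self
  have hε' : ((ε / 2 : ℝ≥0) : ℝ≥0∞) ≠ 0 := by simpa using hε.ne'
  have h1 := ENNReal.lt_add_right hA hε'
  have h2 := ENNReal.lt_add_right hB hε'
  conv_lhs at h1 => rw [capacity]
  conv_lhs at h2 => rw [capacity]
  simp only [iInf_lt_iff] at h1 h2
  obtain ⟨f, ⟨hf, hfA⟩, h1⟩ := h1
  obtain ⟨g, ⟨hg, hgB⟩, h2⟩ := h2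
  have h3 : capacity α s (A ∪ B) ≤ ∫⁻ y, (max (f y) (g y)) ^ s := by
    refine iInf₂_le (fun y => max (f y) (g y)) ⟨hf.max hg, fun x hx => ?_⟩
    rcases hx with hx | hx
    · exact (hfA x hx).trans (lintegral_mono fun y => mul_le_mul_right (le_max_left _ _) _)
    · exact (hgB x hx).trans (lintegral_mono fun y => mul_le_mul_right (le_max_right _ _) _)
  calc _ ≤ ∫⁻ y, (max (f y) (g y)) ^ s := h3
    _ ≤ ∫⁻ y, (f y ^ s + g y ^ s) := by
        refine lintegral_mono fun y => ?_
        rcases max_choice (f y) (g y) with h | h <;> rw [h]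
        · exact le_self_add
        · exact le_add_self
    _ = (∫⁻ y, f y ^ s) + ∫⁻ y, g y ^ s := lintegral_add_left (hf.pow_const s) _
    _ ≤ (capacity α s A + (ε / 2 : ℝ≥0)) + (capacity α s B + (ε / 2 : ℝ≥0)) :=
        add_le_add h1.le h2.le
    _ = capacity α s A + capacity α s B + ((ε / 2 + ε / 2 : ℝ≥0) : ℝ≥0∞) := by
        push_cast; ring
    _ = _ := by rw [add_halves]

/-! ### Capacitary Lorentz spaces -/

/-- The capacitary Lorentz quasi-norm
`‖f‖_{L^{p,q}(C)} = p^{1/q} (∫₀^∞ C({|f| > t})^{q/p} t^q dt/t)^{1/q}`, with `C = Cap_{α,s}`. -/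
noncomputable def lorentzNorm {n : ℕ} (α s p q : ℝ) (f : Rn n → ℝ) : ℝ≥0∞ :=
  ENNReal.ofReal (p ^ (1 / q)) *
    (∫⁻ t in Ioi (0 : ℝ),
      capacity α s {x | t < |f x|} ^ (q / p) * ENNReal.ofReal (t ^ q / t)) ^ (1 / q)

lemma lorentzNorm_zero {n : ℕ} {α s p q : ℝ} (hs : 0 < s) (hp : 0 < p) (hq : 0 < q) :
    lorentzNorm α s p q (0 : Rn n → ℝ) = 0 := by
  have h0 : capacity α s (∅ : Set (Rn n)) = 0 := by
    refine le_antisymm ((iInf₂_le (0 : Rn n → ℝ≥0∞) ⟨measurable_zero, by simp⟩).trans ?_) bot_le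
    simp [ENNReal.zero_rpow_of_pos hs]
  have h1 : ∀ t ∈ Ioi (0 : ℝ), capacity α s {x : Rn n | t < |(0 : Rn n → ℝ) x|} ^ (q / p) *
      ENNReal.ofReal (t ^ q / t) = 0 := fun t ht => by
    have : {x : Rn n | t < |(0 : Rn n → ℝ) x|} = ∅ := by
      ext x; simpa using (mem_Ioi.1 ht).le
    rw [this, h0, ENNReal.zero_rpow_of_pos (div_pos hq hp), zero_mul]
  rw [lorentzNorm, setLIntegral_congr_fun measurableSet_Ioi h1]
  simp [hq]

lemma lorentzNorm_smul_of_pos {n : ℕ} {α s p q : ℝ} (hq : 0 < q) {a : ℝ} (ha : 0 < a)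
    (f : Rn n → ℝ) : lorentzNorm α s p q (a • f) = ENNReal.ofReal a * lorentzNorm α s p q f := by
  have hsub : ∀ H : ℝ → ℝ≥0∞,
      ∫⁻ t in Ioi (0 : ℝ), H t = ENNReal.ofReal a * ∫⁻ t in Ioi (0 : ℝ), H (a * t) := by
    intro H
    rw [← lintegral_indicator measurableSet_Ioi, ← lintegral_indicator measurableSet_Ioi]
    nth_rw 1 [← Real.smul_map_volume_mul_left ha.ne']
    rw [lintegral_smul_measure, abs_of_pos ha, smul_eq_mul]
    congr 1
    have := lintegral_map_equiv (μ := volume) ((Ioi (0 : ℝ)).indicator H)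
      (Homeomorph.mulLeft₀ a ha.ne').toMeasurableEquiv
    refine this.trans (lintegral_congr fun t => ?_)
    simp [indicator, ha]
  have h1 : ∀ t ∈ Ioi (0 : ℝ),
      capacity α s {x | a * t < |(a • f) x|} ^ (q / p) * ENNReal.ofReal ((a * t) ^ q / (a * t)) =
      ENNReal.ofReal (a ^ q / a) *
        (capacity α s {x | t < |f x|} ^ (q / p) * ENNReal.ofReal (t ^ q / t)) := fun t ht => by
    have ht : 0 < t := ht
    have e : {x | a * t < |(a • f) x|} = {x | t < |f x|} := by
      ext x
      simp [abs_mul, abs_of_pos ha, ha]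
    rw [e, Real.mul_rpow ha.le ht.le, mul_div_mul_comm, ENNReal.ofReal_mul (by positivity)]
    ring
  rw [lorentzNorm, hsub, setLIntegral_congr_fun measurableSet_Ioi h1,
    lintegral_const_mul' _ _ ENNReal.ofReal_ne_top, ← mul_assoc, ← ENNReal.ofReal_mul ha.le,
    mul_div_cancel₀ _ ha.ne', ENNReal.mul_rpow_of_nonneg _ _ (by positivity),
    ENNReal.ofReal_rpow_of_pos (by positivity), ← Real.rpow_mul ha.le, mul_one_div_cancel hq.ne',
    Real.rpow_one, lorentzNorm]
  ring

lemma lorentzNorm_neg {n : ℕ} {α s p q : ℝ} (f : Rn n → ℝ) :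
    lorentzNorm α s p q (-f) = lorentzNorm α s p q f := by
  simp [lorentzNorm]

/-- The quasi-triangle inequality. -/
lemma exists_lorentzNorm_add_le {n : ℕ} (α s : ℝ) {p q : ℝ} (hp : 0 < p) (hq : 0 < q) :
    ∃ κ : ℝ≥0, 0 < κ ∧ ∀ f g : Rn n → ℝ,
      lorentzNorm α s p q (f + g) ≤ κ * (lorentzNorm α s p q f + lorentzNorm α s p q g) := by
  have hadd : ∀ (r : ℝ), 0 ≤ r → ∀ a b : ℝ≥0∞, (a + b) ^ r ≤ 2 ^ r * (a ^ r + b ^ r) := by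
    intro r hr a b
    calc (a + b) ^ r ≤ (2 * max a b) ^ r := by
          gcongr; rw [two_mul]; exact add_le_add (le_max_left _ _) (le_max_right _ _)
      _ = 2 ^ r * max a b ^ r := ENNReal.mul_rpow_of_nonneg _ _ hr
      _ ≤ _ := by
          gcongr
          rcases max_choice a b with h | h <;> rw [h]
          · exact le_self_add
          · exact le_add_self
  set J : (Rn n → ℝ) → ℝ≥0∞ := fun f => ∫⁻ t in Ioi (0 : ℝ),
      capacity α s {x | t < |f x|} ^ (q / p) * ENNReal.ofReal (t ^ q / t) with hJ
  have hr : 0 ≤ q / p := by positivity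
  have hmeas : ∀ f : Rn n → ℝ, Measurable fun t : ℝ =>
      capacity α s {x | t < |f x|} ^ (q / p) * ENNReal.ofReal (t ^ q / t) := fun f => by
    have : Antitone fun t : ℝ => capacity α s {x | t < |f x|} := fun t t' h =>
      capacity_mono α s fun x hx => lt_of_le_of_lt h hx
    exact (this.measurable.pow_const _).mul (by fun_prop)
  have hJadd : ∀ f g : Rn n → ℝ,
      J (f + g) ≤ 2 ^ (q / p) * (J ((2 : ℝ) • f) + J ((2 : ℝ) • g)) := by
    intro f g
    simp only [hJ]
    rw [← lintegral_add_left (hmeas _), ← lintegral_const_mul' _ _ (by simp)]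
    refine lintegral_mono fun t => ?_
    simp only
    rw [← add_mul, ← mul_assoc]
    gcongr
    refine le_trans ?_ (hadd _ hr _ _)
    gcongr
    refine le_trans (capacity_mono α s fun x hx => ?_) (capacity_union_le α s _ _)
    simp only [mem_union, mem_ofPred_eq, Pi.add_apply, Pi.smul_apply, smul_eq_mul, abs_mul,
      abs_two] at hx ⊢
    have := abs_add_le (f x) (g x)
    by_contra! hcon
    linarith [hcon.1, hcon.2]
  have hκ : ((2 : ℝ≥0∞) ^ (q / p)) ^ (1 / q) * 2 ^ (1 / q) * 2 ≠ ∞ := by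
    refine ENNReal.mul_ne_top (ENNReal.mul_ne_top ?_ ?_) (by simp)
    · exact ENNReal.rpow_ne_top_of_nonneg (by positivity)
        (ENNReal.rpow_ne_top_of_nonneg hr (by simp))
    · exact ENNReal.rpow_ne_top_of_nonneg (by positivity) (by simp)
  have key : ∀ f g : Rn n → ℝ, lorentzNorm α s p q (f + g) ≤
      (((2 : ℝ≥0∞) ^ (q / p)) ^ (1 / q) * 2 ^ (1 / q) * 2) *
        (lorentzNorm α s p q f + lorentzNorm α s p q g) := by
    intro f g
    have h2 : ∀ f : Rn n → ℝ, 2 * lorentzNorm α s p q f =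
        ENNReal.ofReal (p ^ (1 / q)) * J ((2 : ℝ) • f) ^ (1 / q) := fun f => by
      have := lorentzNorm_smul_of_pos (α := α) (s := s) (p := p) hq (two_pos : (0 : ℝ) < 2) f
      rw [ENNReal.ofReal_ofNat] at this
      exact this.symm
    calc lorentzNorm α s p q (f + g) = ENNReal.ofReal (p ^ (1 / q)) * J (f + g) ^ (1 / q) := rfl
      _ ≤ ENNReal.ofReal (p ^ (1 / q)) *
          (2 ^ (q / p) * (J ((2 : ℝ) • f) + J ((2 : ℝ) • g))) ^ (1 / q) := by
          gcongr; exact hJadd f g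
      _ ≤ ENNReal.ofReal (p ^ (1 / q)) * (((2 : ℝ≥0∞) ^ (q / p)) ^ (1 / q) *
          (2 ^ (1 / q) * (J ((2 : ℝ) • f) ^ (1 / q) + J ((2 : ℝ) • g) ^ (1 / q)))) := by
          rw [ENNReal.mul_rpow_of_nonneg _ _ (by positivity)]
          gcongr
          exact hadd _ (by positivity) _ _
      _ = ((2 : ℝ≥0∞) ^ (q / p)) ^ (1 / q) * 2 ^ (1 / q) *
          (2 * lorentzNorm α s p q f + 2 * lorentzNorm α s p q g) := by
          rw [h2, h2]; ring
      _ = _ := by ring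
  refine ⟨(((2 : ℝ≥0∞) ^ (q / p)) ^ (1 / q) * 2 ^ (1 / q) * 2).toNNReal + 1, by positivity,
    fun f g => (key f g).trans ?_⟩
  push_cast
  rw [ENNReal.coe_toNNReal hκ]
  gcongr
  exact le_self_add

/-- `𝓛^{p,q}(C)`, the closure of the space `C_0` of compactly supported continuous functions in
the capacitary Lorentz space `L^{p,q}(C) = {f : ‖f‖_{L^{p,q}(C)} < ∞}`. -/
def lorentzClosure (n : ℕ) (α : ℝ) {s p q : ℝ} (hs : 0 < s) (hp : 0 < p) (hq : 0 < q) :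
    Submodule ℝ (Rn n → ℝ) where
  carrier := {f | lorentzNorm α s p q f < ∞ ∧
    ∀ ε : ℝ≥0∞, 0 < ε → ∃ φ : C_c(Rn n, ℝ), lorentzNorm α s p q (f - ⇑φ) < ε}
  zero_mem' := by
    have h := lorentzNorm_zero (n := n) (α := α) hs hp hq
    refine ⟨by simp [h], fun ε hε => ⟨0, ?_⟩⟩
    rw [CompactlySupportedContinuousMap.coe_zero, sub_zero, h]
    exact hε
  add_mem' := by
    rintro f g ⟨hf, hf'⟩ ⟨hg, hg'⟩
    obtain ⟨κ, hκ, h⟩ := exists_lorentzNorm_add_le (n := n) α s hp hq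
    refine ⟨(h f g).trans_lt (ENNReal.mul_lt_top ENNReal.coe_lt_top (ENNReal.add_lt_top.2
      ⟨hf, hg⟩)), fun ε hε => ?_⟩
    have hκ0 : (κ : ℝ≥0∞) ≠ 0 := by simpa using hκ.ne'
    have hδ : 0 < ε / κ / 2 :=
      ENNReal.div_pos (ENNReal.div_pos hε.ne' ENNReal.coe_ne_top).ne' (by simp)
    obtain ⟨φ, hφ⟩ := hf' _ hδ
    obtain ⟨ψ, hψ⟩ := hg' _ hδ
    refine ⟨φ + ψ, ?_⟩
    have e : f + g - ⇑(φ + ψ) = (f - ⇑φ) + (g - ⇑ψ) := by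
      rw [CompactlySupportedContinuousMap.coe_add]; abel
    rw [e]
    refine (h _ _).trans_lt ?_
    have h1 := ENNReal.add_lt_add hφ hψ
    rw [ENNReal.add_halves, ENNReal.lt_div_iff_mul_lt (.inl hκ0) (.inl ENNReal.coe_ne_top)] at h1
    rwa [mul_comm]
  smul_mem' := by
    have hpos : ∀ (a : ℝ), 0 < a → ∀ f : Rn n → ℝ, (lorentzNorm α s p q f < ∞ ∧
        ∀ ε : ℝ≥0∞, 0 < ε → ∃ φ : C_c(Rn n, ℝ), lorentzNorm α s p q (f - ⇑φ) < ε) →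
        (lorentzNorm α s p q (a • f) < ∞ ∧ ∀ ε : ℝ≥0∞, 0 < ε →
          ∃ φ : C_c(Rn n, ℝ), lorentzNorm α s p q (a • f - ⇑φ) < ε) := by
      rintro a ha f ⟨hf, hf'⟩
      rw [lorentzNorm_smul_of_pos hq ha]
      refine ⟨ENNReal.mul_lt_top ENNReal.ofReal_lt_top hf, fun ε hε => ?_⟩
      have ha0 : ENNReal.ofReal a ≠ 0 := by simpa using ha
      obtain ⟨φ, hφ⟩ := hf' (ε / ENNReal.ofReal a) (ENNReal.div_pos hε.ne' ENNReal.ofReal_ne_top)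
      refine ⟨a • φ, ?_⟩
      rw [CompactlySupportedContinuousMap.coe_smul, ← smul_sub, lorentzNorm_smul_of_pos hq ha]
      rwa [ENNReal.lt_div_iff_mul_lt (.inl ha0) (.inl ENNReal.ofReal_ne_top), mul_comm] at hφ
    rintro a f hf
    rcases lt_trichotomy a 0 with ha | rfl | ha
    · obtain ⟨h1, h2⟩ := hpos (-a) (neg_pos.2 ha) f hf
      have e : a • f = -((-a) • f) := by rw [neg_smul, neg_neg]
      refine ⟨by rwa [e, lorentzNorm_neg], fun ε hε => ?_⟩
      obtain ⟨φ, hφ⟩ := h2 ε hε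
      refine ⟨-φ, ?_⟩
      rw [CompactlySupportedContinuousMap.coe_neg, e, sub_neg_eq_add, ← lorentzNorm_neg]
      convert hφ using 2
      abel
    · have h := lorentzNorm_zero (n := n) (α := α) hs hp hq
      rw [zero_smul]
      refine ⟨by simp [h], fun ε hε => ⟨0, ?_⟩⟩
      rw [CompactlySupportedContinuousMap.coe_zero, sub_zero, h]
      exact hε
    · exact hpos a ha f hf

/-! ### Continuous linear functionals on a space with a quasi-norm -/

/-- The linear functionals on a space `X` of functions that are continuous for the topology induced
by a quasi-norm `N`. -/
def continuousDual {n : ℕ} (X : Submodule ℝ (Rn n → ℝ)) (N : (Rn n → ℝ) → ℝ≥0∞) :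
    Submodule ℝ (X →ₗ[ℝ] ℝ) where
  carrier := {L | ∀ f : X, ∀ ε : ℝ, 0 < ε → ∃ δ : ℝ≥0∞, 0 < δ ∧
    ∀ g : X, N ((g : Rn n → ℝ) - f) < δ → |L g - L f| < ε}
  zero_mem' := fun f ε hε => ⟨1, one_pos, fun g _ => by simpa using hε⟩
  add_mem' := by
    intro L M hL hM f ε hε
    obtain ⟨δ, hδ, h⟩ := hL f (ε / 2) (half_pos hε)
    obtain ⟨δ', hδ', h'⟩ := hM f (ε / 2) (half_pos hε)
    refine ⟨min δ δ', lt_min hδ hδ', fun g hg => ?_⟩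
    have h1 := h g (hg.trans_le (min_le_left _ _))
    have h2 := h' g (hg.trans_le (min_le_right _ _))
    have : (L + M) g - (L + M) f = (L g - L f) + (M g - M f) := by
      simp only [LinearMap.add_apply]; ring
    rw [this]
    exact (abs_add_le _ _).trans_lt (by linarith)
  smul_mem' := by
    intro c L hL f ε hε
    have hc : 0 < |c| + 1 := by positivity
    obtain ⟨δ, hδ, h⟩ := hL f (ε / (|c| + 1)) (div_pos hε hc)
    refine ⟨δ, hδ, fun g hg => ?_⟩
    have h1 := h g hg
    rw [lt_div_iff₀ hc] at h1
    have : (c • L) g - (c • L) f = c * (L g - L f) := by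
      simp only [LinearMap.smul_apply, smul_eq_mul]; ring
    rw [this, abs_mul]
    nlinarith [abs_nonneg (L g - L f), abs_nonneg c]

/-- The operator norm `‖L‖ = sup {|L f| : N f ≤ 1}` of a linear functional on `X`. -/
noncomputable def opNorm {n : ℕ} {X : Submodule ℝ (Rn n → ℝ)} (N : (Rn n → ℝ) → ℝ≥0∞)
    (L : X →ₗ[ℝ] ℝ) : ℝ≥0∞ :=
  ⨆ (f : X) (_ : N f ≤ 1), ENNReal.ofReal |L f|

/-! ### Measures as functionals on `C_0` -/

/-- The (real) measures on `ℝⁿ`: the linear functionals on `C_0` that are continuous for the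
inductive limit topology, i.e. whose restriction to the functions supported in a fixed compact set
is continuous for uniform convergence. -/
def radonMeasures (n : ℕ) : Submodule ℝ (C_c(Rn n, ℝ) →ₗ[ℝ] ℝ) where
  carrier := {μ | ∀ K : Set (Rn n), IsCompact K → ∃ C : ℝ, 0 ≤ C ∧ ∀ φ : C_c(Rn n, ℝ),
    tsupport φ ⊆ K → ∀ b : ℝ, (∀ x, |φ x| ≤ b) → |μ φ| ≤ C * b}
  zero_mem' := fun K _ => ⟨0, le_rfl, fun φ _ b _ => by simp⟩
  add_mem' := by
    intro μ ν hμ hν K hK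
    obtain ⟨C, hC, h⟩ := hμ K hK
    obtain ⟨D, hD, h'⟩ := hν K hK
    refine ⟨C + D, add_nonneg hC hD, fun φ hφ b hb => ?_⟩
    rw [LinearMap.add_apply, add_mul]
    exact (abs_add_le _ _).trans (add_le_add (h φ hφ b hb) (h' φ hφ b hb))
  smul_mem' := by
    intro c μ hμ K hK
    obtain ⟨C, hC, h⟩ := hμ K hK
    refine ⟨|c| * C, by positivity, fun φ hφ b hb => ?_⟩
    rw [LinearMap.smul_apply, smul_eq_mul, abs_mul, mul_assoc]
    exact mul_le_mul_of_nonneg_left (h φ hφ b hb) (abs_nonneg c)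

/-- The dual `𝓛^{p,q}(C)^*` of `𝓛^{p,q}(C)`. -/
noncomputable abbrev lorentzDual (n : ℕ) (α : ℝ) {s p q : ℝ} (hs : 0 < s) (hp : 0 < p) (hq : 0 < q) :
    Submodule ℝ (lorentzClosure n α hs hp hq →ₗ[ℝ] ℝ) :=
  continuousDual (lorentzClosure n α hs hp hq) (lorentzNorm α s p q)

variable {n : ℕ}

/-- The values `|μ(ψ)|` for `ψ ∈ C_0` with `|ψ| ≤ φ`. -/
def variationSet (μ : radonMeasures n) (φ : C_c(Rn n, ℝ≥0)) : Set ℝ :=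
  {r | ∃ ψ : C_c(Rn n, ℝ), (∀ x, |ψ x| ≤ φ x) ∧ r = |(μ : C_c(Rn n, ℝ) →ₗ[ℝ] ℝ) ψ|}

/-- The total variation `|μ|(φ) = sup {|μ(ψ)| : ψ ∈ C_0, |ψ| ≤ φ}` on nonnegative `φ ∈ C_0`. -/
noncomputable def variationFun (μ : radonMeasures n) (φ : C_c(Rn n, ℝ≥0)) : ℝ :=
  sSup (variationSet μ φ)

lemma variationSet_bddAbove (μ : radonMeasures n) (φ : C_c(Rn n, ℝ≥0)) :
    BddAbove (variationSet μ φ) := by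
  obtain ⟨C, hC, h⟩ := μ.2 (tsupport φ) φ.hasCompactSupport
  obtain ⟨b, hb⟩ : ∃ b : ℝ, ∀ x, ((φ x : ℝ≥0) : ℝ) ≤ b := by
    obtain ⟨b, hb⟩ := (φ.hasCompactSupport.isCompact_range φ.continuous).bddAbove
    exact ⟨b, fun x => NNReal.coe_le_coe.2 (hb ⟨x, rfl⟩)⟩
  refine ⟨C * b, ?_⟩
  rintro r ⟨ψ, hψ, rfl⟩
  refine h ψ (closure_mono fun x hx => ?_) b fun x => (hψ x).trans (hb x)
  intro h0
  apply hx
  have := hψ x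
  rw [h0] at this
  simpa using this

lemma le_variationFun (μ : radonMeasures n) {φ : C_c(Rn n, ℝ≥0)} {ψ : C_c(Rn n, ℝ)}
    (h : ∀ x, |ψ x| ≤ φ x) : |(μ : C_c(Rn n, ℝ) →ₗ[ℝ] ℝ) ψ| ≤ variationFun μ φ :=
  le_csSup (variationSet_bddAbove μ φ) ⟨ψ, h, rfl⟩

lemma variationFun_le (μ : radonMeasures n) {φ : C_c(Rn n, ℝ≥0)} {a : ℝ}
    (h : ∀ ψ : C_c(Rn n, ℝ), (∀ x, |ψ x| ≤ φ x) → (μ : C_c(Rn n, ℝ) →ₗ[ℝ] ℝ) ψ ≤ a) :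
    variationFun μ φ ≤ a := by
  refine csSup_le ⟨_, 0, by simp, rfl⟩ ?_
  rintro r ⟨ψ, hψ, rfl⟩
  refine abs_le'.2 ⟨h ψ hψ, ?_⟩
  rw [← map_neg]
  exact h (-ψ) (by simpa using hψ)

lemma variationFun_nonneg (μ : radonMeasures n) (φ : C_c(Rn n, ℝ≥0)) : 0 ≤ variationFun μ φ :=
  (abs_nonneg _).trans (le_variationFun μ (ψ := 0) (by simp))

lemma variationFun_add (μ : radonMeasures n) (φ₁ φ₂ : C_c(Rn n, ℝ≥0)) :
    variationFun μ (φ₁ + φ₂) = variationFun μ φ₁ + variationFun μ φ₂ := by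
  apply le_antisymm
  · refine variationFun_le μ fun ψ hψ => ?_
    set ψ₁ : C_c(Rn n, ℝ) := (ψ ⊓ φ₁.toReal) ⊔ (-φ₁.toReal) with hψ₁
    have e : ∀ x, ψ₁ x = max (min (ψ x) (φ₁ x)) (-(φ₁ x)) := fun x => by simp [hψ₁]
    have h1 : ∀ x, |ψ₁ x| ≤ φ₁ x := fun x => by
      have := (φ₁ x).2
      rw [e, abs_le]
      exact ⟨le_max_right _ _, max_le (min_le_right _ _) (by simp)⟩
    have h2 : ∀ x, |(ψ - ψ₁) x| ≤ φ₂ x := fun x => by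
      have h3 := (φ₁ x).2
      have h4 := (φ₂ x).2
      have h5 := hψ x
      simp only [CompactlySupportedContinuousMap.add_apply, NNReal.coe_add] at h5
      rw [CompactlySupportedContinuousMap.sub_apply, e]
      rw [abs_le] at h5 ⊢
      simp only [NNReal.val_eq_coe] at h3 h4
      rcases le_total (ψ x) (φ₁ x) with h6 | h6
      · rw [min_eq_left h6]
        rcases le_total (ψ x) (-(φ₁ x)) with h7 | h7
        · rw [max_eq_right h7]; constructor <;> linarith
        · rw [max_eq_left h7]; constructor <;> linarith
      · rw [min_eq_right h6, max_eq_left (by linarith)]; constructor <;> linarith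
    have h3 := (le_abs_self _).trans (le_variationFun μ h1)
    have h4 := (le_abs_self _).trans (le_variationFun μ h2)
    rw [map_sub] at h4
    linarith
  · have key : ∀ ψ₁ : C_c(Rn n, ℝ), (∀ x, |ψ₁ x| ≤ φ₁ x) → ∀ ψ₂ : C_c(Rn n, ℝ),
        (∀ x, |ψ₂ x| ≤ φ₂ x) → (μ : C_c(Rn n, ℝ) →ₗ[ℝ] ℝ) ψ₁ +
          (μ : C_c(Rn n, ℝ) →ₗ[ℝ] ℝ) ψ₂ ≤ variationFun μ (φ₁ + φ₂) := by
      intro ψ₁ h1 ψ₂ h2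
      rw [← map_add]
      refine (le_abs_self _).trans (le_variationFun μ fun x => ?_)
      simp only [CompactlySupportedContinuousMap.add_apply, NNReal.coe_add]
      exact (abs_add_le _ _).trans (add_le_add (h1 x) (h2 x))
    rw [← le_sub_iff_add_le]
    refine variationFun_le μ fun ψ₁ h1 => ?_
    rw [le_sub_iff_add_le, ← le_sub_iff_add_le']
    refine variationFun_le μ fun ψ₂ h2 => ?_
    rw [le_sub_iff_add_le']
    exact key ψ₁ h1 ψ₂ h2

lemma variationFun_smul_le (μ : radonMeasures n) (c : ℝ≥0) (φ : C_c(Rn n, ℝ≥0)) :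
    c * variationFun μ φ ≤ variationFun μ (c • φ) := by
  rcases eq_or_ne c 0 with rfl | hc
  · simpa using variationFun_nonneg μ _
  have hc' : (0 : ℝ) < c := by positivity
  rw [← le_div_iff₀' hc']
  refine variationFun_le μ fun ψ hψ => ?_
  rw [le_div_iff₀' hc', ← smul_eq_mul, ← map_smul]
  refine (le_abs_self _).trans (le_variationFun μ fun x => ?_)
  simp only [CompactlySupportedContinuousMap.smul_apply, smul_eq_mul, NNReal.coe_mul, abs_mul,
    NNReal.abs_eq]
  exact mul_le_mul_of_nonneg_left (hψ x) c.2

lemma variationFun_smul (μ : radonMeasures n) (c : ℝ≥0) (φ : C_c(Rn n, ℝ≥0)) :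
    variationFun μ (c • φ) = c * variationFun μ φ := by
  refine le_antisymm ?_ (variationFun_smul_le μ c φ)
  rcases eq_or_ne c 0 with rfl | hc
  · rw [zero_smul]
    refine variationFun_le μ fun ψ hψ => ?_
    have : ψ = 0 := by ext x; simpa using hψ x
    simp [this]
  have hc' : (0 : ℝ) < c := by positivity
  have := variationFun_smul_le μ c⁻¹ (c • φ)
  rw [smul_smul, inv_mul_cancel₀ hc, one_smul, NNReal.coe_inv, inv_mul_le_iff₀ hc'] at this
  exact this

lemma abs_toReal_le_variationFun (μ : radonMeasures n) (φ : C_c(Rn n, ℝ≥0)) :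
    |(μ : C_c(Rn n, ℝ) →ₗ[ℝ] ℝ) φ.toReal| ≤ variationFun μ φ :=
  le_variationFun μ fun x => by simp

/-- `|μ|` as a positive linear functional. -/
noncomputable def variationFunctional (μ : radonMeasures n) : C_c(Rn n, ℝ≥0) →ₗ[ℝ≥0] ℝ≥0 where
  toFun φ := ⟨variationFun μ φ, variationFun_nonneg μ φ⟩
  map_add' φ₁ φ₂ := NNReal.eq (variationFun_add μ φ₁ φ₂)
  map_smul' c φ := NNReal.eq (variationFun_smul μ c φ)

/-- `μ⁺ = (|μ| + μ) / 2` as a positive linear functional. -/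
noncomputable def posFunctional (μ : radonMeasures n) : C_c(Rn n, ℝ≥0) →ₗ[ℝ≥0] ℝ≥0 where
  toFun φ := ⟨(variationFun μ φ + (μ : C_c(Rn n, ℝ) →ₗ[ℝ] ℝ) φ.toReal) / 2, by
    have := (abs_le.1 (abs_toReal_le_variationFun μ φ)).1
    linarith⟩
  map_add' φ₁ φ₂ := NNReal.eq (by
    change _ / 2 = _ / 2 + _ / 2
    simp only [variationFun_add, CompactlySupportedContinuousMap.toReal_add, map_add]
    ring)
  map_smul' c φ := NNReal.eq (by
    have : (μ : C_c(Rn n, ℝ) →ₗ[ℝ] ℝ) (c • φ).toReal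
        = c * (μ : C_c(Rn n, ℝ) →ₗ[ℝ] ℝ) φ.toReal := by
      rw [CompactlySupportedContinuousMap.toReal_smul, ← smul_eq_mul, ← map_smul]; rfl
    change _ / 2 = (c : ℝ) * (_ / 2)
    rw [variationFun_smul, this]
    ring)

/-- The total variation measure `|μ|`, as a regular Borel measure. Since Borel measures are extended
to all subsets as outer measures in Mathlib, `totalVariation μ E` is the outer measure `|μ|^*(E)`
for an arbitrary set `E`. -/
noncomputable def totalVariation (μ : radonMeasures n) : Measure (Rn n) :=
  NNRealRMK.rieszMeasure (variationFunctional μ)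

/-- The positive part `μ⁺` of `μ`. -/
noncomputable def posMeasure (μ : radonMeasures n) : Measure (Rn n) :=
  NNRealRMK.rieszMeasure (posFunctional μ)

/-- The negative part `μ⁻ = (-μ)⁺` of `μ`. -/
noncomputable def negMeasure (μ : radonMeasures n) : Measure (Rn n) := posMeasure (-μ)

/-- The integral `∫ f dμ = ∫ f dμ⁺ - ∫ f dμ⁻` (meaningful when `f` is `|μ|`-integrable). -/
noncomputable def signedIntegral (μ : radonMeasures n) (f : Rn n → ℝ) : ℝ :=
  ∫ x, f x ∂(posMeasure μ) - ∫ x, f x ∂(negMeasure μ)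

lemma variationFun_neg (μ : radonMeasures n) (φ : C_c(Rn n, ℝ≥0)) :
    variationFun (-μ) φ = variationFun μ φ := by
  simp [variationFun, variationSet]

/-- The integral extends the functional `μ`. -/
theorem signedIntegral_coe (μ : radonMeasures n) (φ : C_c(Rn n, ℝ)) :
    signedIntegral μ φ = (μ : C_c(Rn n, ℝ) →ₗ[ℝ] ℝ) φ := by
  have h0 : ∀ ψ : C_c(Rn n, ℝ≥0),
      signedIntegral μ ψ.toReal = (μ : C_c(Rn n, ℝ) →ₗ[ℝ] ℝ) ψ.toReal := by
    intro ψ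
    simp only [signedIntegral, posMeasure, negMeasure, CompactlySupportedContinuousMap.toReal_apply,
      NNRealRMK.integral_rieszMeasure]
    change (variationFun μ ψ + _) / 2 - (variationFun (-μ) ψ + _) / 2 = _
    rw [variationFun_neg]
    simp only [Submodule.coe_neg, LinearMap.neg_apply]
    ring
  have hi : ∀ (ν : radonMeasures n) (ψ : C_c(Rn n, ℝ)), Integrable ψ (posMeasure ν) := fun ν ψ => by
    unfold posMeasure
    exact ψ.continuous.integrable_of_hasCompactSupport ψ.hasCompactSupport
  have h1 : φ = φ.nnrealPart.toReal - (-φ).nnrealPart.toReal :=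
    (CompactlySupportedContinuousMap.nnrealPart_sub_nnrealPart_neg φ).symm
  have h2 := h0 φ.nnrealPart
  have h3 := h0 (-φ).nnrealPart
  conv_rhs => rw [h1, map_sub, ← h2, ← h3]
  conv_lhs => rw [h1]
  simp only [signedIntegral, CompactlySupportedContinuousMap.sub_apply]
  rw [integral_sub (hi _ _) (hi _ _), negMeasure, integral_sub (hi _ _) (hi _ _)]
  ring

/-- The outer measure of `|μ|` is `|μ|^*(E) = inf {|μ|(G) : G ⊇ E open}`, where
`|μ|(G) = sup {|μ|(φ) : φ ∈ C_0, 0 ≤ φ ≤ χ_G}`. -/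
theorem totalVariation_apply (μ : radonMeasures n) (E : Set (Rn n)) :
    totalVariation μ E = ⨅ (G : Set (Rn n)) (_ : E ⊆ G) (_ : IsOpen G),
      ⨆ (φ : C_c(Rn n, ℝ≥0)) (_ : ∀ x, φ x ≤ G.indicator 1 x),
        ENNReal.ofReal (variationFun μ φ) := by
  have hv : ∀ φ : C_c(Rn n, ℝ≥0),
      ENNReal.ofReal (variationFun μ φ) = ∫⁻ x, φ x ∂(totalVariation μ) := fun φ => by
    rw [totalVariation, NNRealRMK.lintegral_rieszMeasure,
      ENNReal.ofReal_eq_coe_nnreal (variationFun_nonneg μ φ)]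
    rfl
  rw [totalVariation, Set.measure_eq_iInf_isOpen, ← totalVariation]
  refine iInf_congr fun G => iInf_congr fun _ => iInf_congr fun hG => le_antisymm ?_ ?_
  · rw [totalVariation, hG.measure_eq_iSup_isCompact, ← totalVariation]
    refine iSup_le fun K => iSup_le fun hKG => iSup_le fun hK => ?_
    obtain ⟨f, hf1, hf0, hfc, hf⟩ := exists_continuous_one_zero_of_isCompact hK hG.isClosed_compl
      (disjoint_compl_right_iff_subset.2 hKG)
    let ψ : C_c(Rn n, ℝ) := ⟨f, hfc⟩
    refine le_iSup₂_of_le ψ.nnrealPart (fun x => ?_) ?_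
    · rw [CompactlySupportedContinuousMap.nnrealPart_apply]
      by_cases hx : x ∈ G
      · have : ψ x ≤ 1 := (hf x).2
        simpa [hx] using this
      · have : ψ x = 0 := hf0 hx
        simp [hx, this]
    · rw [hv, ← lintegral_indicator_one hK.measurableSet]
      refine lintegral_mono fun x => ?_
      by_cases hx : x ∈ K
      · have : ψ x = 1 := hf1 hx
        simp [hx, this]
      · simp [hx]
  · refine iSup₂_le fun φ hφ => ?_
    rw [hv, ← lintegral_indicator_one hG.measurableSet]
    refine lintegral_mono fun x => ?_
    have := hφ x
    by_cases hx : x ∈ G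
    · simpa [hx] using this
    · simpa [hx] using this

lemma totalVariation_le_of_variationFun_le {μ ν ρ : radonMeasures n} {c d : ℝ≥0}
    (h : ∀ φ, variationFun ρ φ ≤ c * variationFun μ φ + d * variationFun ν φ)
    {K : Set (Rn n)} (hK : IsCompact K) :
    totalVariation ρ K ≤ c * totalVariation μ K + d * totalVariation ν K := by
  have e : ∀ σ : radonMeasures n, totalVariation σ K
      = (rieszContentAux (variationFunctional σ) ⟨K, hK⟩ : ℝ≥0) := fun σ =>
    (rieszContent _).measure_eq_content_of_regular (contentRegular_rieszContent _) ⟨K, hK⟩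
  rw [e, e, e]
  norm_cast
  refine le_of_forall_pos_le_add fun ε hε => ?_
  set δ : ℝ≥0 := ε / (c + d + 1) with hδ
  have hδ0 : 0 < δ := by positivity
  obtain ⟨f, hf, hf'⟩ := exists_lt_rieszContentAux_add_pos (variationFunctional μ) ⟨K, hK⟩ hδ0
  obtain ⟨g, hg, hg'⟩ := exists_lt_rieszContentAux_add_pos (variationFunctional ν) ⟨K, hK⟩ hδ0
  have h1 : rieszContentAux (variationFunctional ρ) ⟨K, hK⟩ ≤ variationFunctional ρ (f ⊓ g) :=
    rieszContentAux_le _ fun x hx => le_inf (hf x hx) (hg x hx)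
  have h2 : variationFunctional ρ (f ⊓ g) ≤
      c * variationFunctional μ (f ⊓ g) + d * variationFunctional ν (f ⊓ g) :=
    NNReal.coe_le_coe.1 (h (f ⊓ g))
  have h3 := CompactlySupportedContinuousMap.monotone_of_nnreal (variationFunctional μ)
    (inf_le_left : f ⊓ g ≤ f)
  have h4 := CompactlySupportedContinuousMap.monotone_of_nnreal (variationFunctional ν)
    (inf_le_right : f ⊓ g ≤ g)
  have h5 : c * δ + d * δ ≤ ε := by
    rw [← add_mul, hδ, mul_div_assoc', div_le_iff₀ (by positivity), mul_comm]
    exact mul_le_mul_of_nonneg_left (by simp) ε.2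
  calc _ ≤ c * variationFunctional μ (f ⊓ g) + d * variationFunctional ν (f ⊓ g) := h1.trans h2
    _ ≤ c * (rieszContentAux (variationFunctional μ) ⟨K, hK⟩ + δ) +
        d * (rieszContentAux (variationFunctional ν) ⟨K, hK⟩ + δ) := by
      gcongr
      · exact h3.trans hf'.le
      · exact h4.trans hg'.le
    _ = c * rieszContentAux (variationFunctional μ) ⟨K, hK⟩ +
        d * rieszContentAux (variationFunctional ν) ⟨K, hK⟩ + (c * δ + d * δ) := by ring
    _ ≤ _ := by gcongr

/-- `‖μ‖_𝔐 = sup_K |μ|(K) / C(K)`, over the compact sets `K` of nonzero capacity. -/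
noncomputable def traceNorm (α s : ℝ) (μ : radonMeasures n) : ℝ≥0∞ :=
  ⨆ (K : Set (Rn n)) (_ : IsCompact K) (_ : capacity α s K ≠ 0),
    totalVariation μ K / capacity α s K

lemma traceNorm_le {α s : ℝ} {μ ν ρ : radonMeasures n} {c d : ℝ≥0}
    (h : ∀ φ, variationFun ρ φ ≤ c * variationFun μ φ + d * variationFun ν φ) :
    traceNorm α s ρ ≤ c * traceNorm α s μ + d * traceNorm α s ν := by
  refine iSup_le fun K => iSup₂_le fun hK hc => ?_
  have key : ∀ σ : radonMeasures n,
      totalVariation σ K / capacity α s K ≤ traceNorm α s σ := fun σ =>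
    le_iSup_of_le K (le_iSup₂_of_le hK hc le_rfl)
  calc _ ≤ (c * totalVariation μ K + d * totalVariation ν K) / capacity α s K := by
        gcongr; exact totalVariation_le_of_variationFun_le h hK
    _ = c * (totalVariation μ K / capacity α s K) + d * (totalVariation ν K / capacity α s K) := by
        rw [ENNReal.add_div, mul_div_assoc, mul_div_assoc]
    _ ≤ _ := by gcongr <;> exact key _

/-- The space `𝔐` of the measures `μ` with `‖μ‖_𝔐 < ∞`. -/
def traceMeasures (n : ℕ) (α s : ℝ) : Submodule ℝ (radonMeasures n) where
  carrier := {μ | traceNorm α s μ < ∞}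
  zero_mem' := by
    have := traceNorm_le (α := α) (s := s) (μ := (0 : radonMeasures n)) (ν := 0) (ρ := 0)
      (c := 0) (d := 0) fun φ => variationFun_le _ fun ψ _ => by simp
    exact this.trans_lt (by simp)
  add_mem' := by
    intro μ ν hμ hν
    have := traceNorm_le (α := α) (s := s) (μ := μ) (ν := ν) (ρ := μ + ν) (c := 1) (d := 1)
      fun φ => variationFun_le _ fun ψ hψ => by
        simp only [Submodule.coe_add, LinearMap.add_apply, NNReal.coe_one, one_mul]
        exact add_le_add ((le_abs_self _).trans (le_variationFun μ hψ))
          ((le_abs_self _).trans (le_variationFun ν hψ))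
    refine this.trans_lt ?_
    simpa using ⟨hμ, hν⟩
  smul_mem' := by
    intro a μ hμ
    have := traceNorm_le (α := α) (s := s) (μ := μ) (ν := 0) (ρ := a • μ) (c := ‖a‖₊) (d := 0)
      fun φ => variationFun_le _ fun ψ hψ => by
        simp only [Submodule.coe_smul, LinearMap.smul_apply, NNReal.coe_zero, zero_mul, add_zero,
          smul_eq_mul, coe_nnnorm, Real.norm_eq_abs]
        refine (le_abs_self _).trans ?_
        rw [abs_mul]
        exact mul_le_mul_of_nonneg_left (le_variationFun μ hψ) (abs_nonneg a)
    refine this.trans_lt ?_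
    simpa using ENNReal.mul_lt_top ENNReal.coe_lt_top hμ

end CapacitaryLorentz

open CapacitaryLorentz

namespace CapacitaryLorentz

open Filter Topology

/-! ### The Bessel kernel and the Bessel capacity -/

/-! Write C for the capacity and N for the quasi-norm of L^{1,q}(C). For the upper bound, suppose
|μ|(E) ≤ a C(E) for all E. The layer-cake formula gives ∫ |f| d|μ| = ∫₀^∞ |μ|({|f| > t}) dt ≤ a ∫₀^∞
C({|f| > t}) dt. For q ≤ 1 the last integral is at most N(f) (`lintegral_capacity_superlevel_le`):
the weak-type bound t C({|f| > t}) ≤ N(f) absorbs the power C^{1-q}. Hence L_μ is bounded.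

For the converse, test a continuous functional on ψ ∈ C_0 with |ψ| ≤ 1 and support in an open set U.
Then N(ψ) ≤ q^{-1/q} C(U), so the restriction of the functional to C_0 is a measure μ with |μ|(U)
bounded by a multiple of C(U) (`totalVariation_le_of_apply_le`). As C_0 is dense in 𝓛^{1,q}(C), the
functional is L_μ (`lorentzDual_ext`). Density also gives injectivity, and linearity in μ.

Two properties of C link the estimates for compact, open and arbitrary sets. Bessel potentials are
lower semicontinuous, so C is outer regular (`exists_isOpen_capacity_lt`). Also C dominates Lebesgue
measure (`volume_le_capacity`), so every compact set can be enlarged slightly to one of positive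
capacity; compact sets of capacity zero, which the supremum defining ‖μ‖_𝔐 leaves out, are
controlled in this way.

No linearity of C is needed, and the quasi-triangle inequality serves only to make 𝓛^{1,q}(C) a
vector space. -/

lemma measurable_besselKernel {n : ℕ} (α : ℝ) : Measurable (besselKernel α : Rn n → ℝ≥0∞) :=
  (measurable_besselIntegrand α).ennreal_ofReal.lintegral_prod_right'

lemma besselIntegrand_pos {n : ℕ} {α : ℝ} (hα : 0 < α) (x : Rn n) {t : ℝ} (ht : 0 < t) :
    0 < besselIntegrand α x t := by
  have := Real.Gamma_pos_of_pos (half_pos hα)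
  unfold besselIntegrand
  positivity

lemma besselKernel_pos {n : ℕ} {α : ℝ} (hα : 0 < α) (x : Rn n) : 0 < besselKernel α x := by
  have hm : Measurable fun t : ℝ => ENNReal.ofReal (besselIntegrand α x t) :=
    ((measurable_besselIntegrand α).comp measurable_prodMk_left).ennreal_ofReal
  rw [besselKernel, setLIntegral_pos_iff hm]
  have : Ioi (0 : ℝ) ⊆
      (Function.support fun t : ℝ => ENNReal.ofReal (besselIntegrand α x t)) ∩ Ioi 0 :=
    fun t ht => ⟨by simpa using besselIntegrand_pos hα x ht, ht⟩
  exact lt_of_lt_of_le (by simp) (measure_mono this)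

/-- Fatou's lemma in t, the integrand being continuous in x for each t. The kernel may be infinite
at the origin, so lower semicontinuity is the form of continuity used. -/
lemma besselKernel_le_liminf {n : ℕ} (α : ℝ) (x : Rn n) :
    besselKernel α x ≤ liminf (besselKernel α) (𝓝 x) := by
  refine le_trans (le_of_eq ?_) (lintegral_liminf_le fun y =>
    ((measurable_besselIntegrand α).comp measurable_prodMk_left).ennreal_ofReal)
  refine lintegral_congr fun t => (Tendsto.liminf_eq ?_).symm
  have : Continuous fun y : Rn n => besselIntegrand α y t := by
    unfold besselIntegrand
    fun_prop
  exact (ENNReal.continuous_ofReal.comp this).tendsto x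

/-- Bessel potentials of nonnegative functions are lower semicontinuous. -/
lemma lowerSemicontinuous_besselPotential {n : ℕ} (α : ℝ) {f : Rn n → ℝ≥0∞} (hf : Measurable f) :
    LowerSemicontinuous fun x => ∫⁻ y, besselKernel α (x - y) * f y := by
  refine lowerSemicontinuous_iff_le_liminf.2 fun x => ?_
  have hm : ∀ z : Rn n, Measurable fun y : Rn n => besselKernel α (z - y) * f y := fun z =>
    ((measurable_besselKernel α).comp (measurable_const.sub measurable_id)).mul hf
  have key : ∀ y : Rn n, besselKernel α (x - y) * f y ≤
      liminf (fun z : Rn n => besselKernel α (z - y) * f y) (𝓝 x) := by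
    intro y
    have h2 : Tendsto (fun z : Rn n => z - y) (𝓝 x) (𝓝 (x - y)) :=
      (continuous_id.sub continuous_const).tendsto x
    have h1 : besselKernel α (x - y) ≤ liminf (fun z : Rn n => besselKernel α (z - y)) (𝓝 x) := by
      have h3 := besselKernel_le_liminf α (x - y)
      have h4 : liminf (besselKernel α) (𝓝 (x - y)) ≤
          liminf (besselKernel α) (map (fun z : Rn n => z - y) (𝓝 x)) := liminf_le_liminf_of_le h2
      rw [← liminf_comp] at h4
      exact h3.trans h4
    have h3 := ENNReal.le_liminf_mul (f := 𝓝 x) (u := fun z => besselKernel α (z - y))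
      (v := fun _ => f y)
    rw [liminf_const] at h3
    exact (mul_le_mul_left h1 _).trans h3
  exact (lintegral_mono key).trans (lintegral_liminf_le hm)

lemma capacity_le {n : ℕ} {α s : ℝ} {E : Set (Rn n)} {f : Rn n → ℝ≥0∞} (hf : Measurable f)
    (h : ∀ x ∈ E, 1 ≤ ∫⁻ y, besselKernel α (x - y) * f y) :
    capacity α s E ≤ ∫⁻ y, f y ^ s :=
  iInf₂_le f ⟨hf, h⟩

lemma capacity_empty {n : ℕ} {α s : ℝ} (hs : 0 < s) : capacity α s (∅ : Set (Rn n)) = 0 := by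
  refine le_antisymm ((capacity_le (f := 0) measurable_zero (by simp)).trans ?_) bot_le
  simp [ENNReal.zero_rpow_of_pos hs]

/-- The Bessel capacity is an outer capacity. -/
lemma exists_isOpen_capacity_lt {n : ℕ} {α s : ℝ} (hs : 0 < s) {E : Set (Rn n)} {a : ℝ≥0∞}
    (ha : capacity α s E < a) : ∃ G, E ⊆ G ∧ IsOpen G ∧ capacity α s G < a := by
  conv_lhs at ha => rw [capacity]
  simp only [iInf_lt_iff] at ha
  obtain ⟨f, ⟨hf, hfE⟩, hfa⟩ := ha
  -- Multiplying a competitor by c > 1 turns "≥ 1 on E" into "> 1", which holds on an open set by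
  -- lower semicontinuity. For c close to 1 the energy, which scales by c^s, stays below `a`.
  obtain ⟨c, hc1, hc⟩ : ∃ c : ℝ≥0, 1 < c ∧ (c : ℝ≥0∞) ^ s * ∫⁻ y, f y ^ s < a := by
    have h1 : Tendsto (fun c : ℝ≥0 => (c : ℝ≥0∞) ^ s * ∫⁻ y, f y ^ s) (𝓝[>] 1)
        (𝓝 ((1 : ℝ≥0) ^ s * ∫⁻ y, f y ^ s)) := by
      refine ENNReal.Tendsto.mul_const ?_ (.inl (by simp))
      refine Tendsto.mono_left ?_ nhdsWithin_le_nhds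
      exact ((ENNReal.continuous_rpow_const.comp ENNReal.continuous_coe).tendsto (1 : ℝ≥0))
    have h2 := (h1.eventually (Iio_mem_nhds (by simpa using hfa))).and
      self_mem_nhdsWithin
    obtain ⟨c, hc, hc'⟩ := h2.exists
    exact ⟨c, hc', hc⟩
  have e : ∀ x, ∫⁻ y, besselKernel α (x - y) * (c * f y) =
      c * ∫⁻ y, besselKernel α (x - y) * f y := fun x => by
    rw [← lintegral_const_mul' _ _ ENNReal.coe_ne_top]
    exact lintegral_congr fun y => by ring
  refine ⟨{x | 1 < ∫⁻ y, besselKernel α (x - y) * (c * f y)}, fun x hx => ?_, ?_, ?_⟩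
  · rw [mem_ofPred_eq, e]
    have h1 : (1 : ℝ≥0∞) < c := by exact_mod_cast hc1
    exact h1.trans_le (le_mul_of_one_le_right bot_le (hfE x hx))
  · exact (lowerSemicontinuous_besselPotential α (hf.const_mul _)).isOpen_preimage 1
  · refine (capacity_le (hf.const_mul (c : ℝ≥0∞)) fun x hx => le_of_lt hx).trans_lt ?_
    simp_rw [ENNReal.mul_rpow_of_nonneg _ _ hs.le]
    rwa [lintegral_const_mul' _ _ (ENNReal.rpow_ne_top_of_nonneg hs.le ENNReal.coe_ne_top)]

/-- Jensen's inequality for the Bessel potential. -/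
lemma besselPotential_rpow_le {n : ℕ} {α s : ℝ} (hα : 0 < α) (hs : 1 ≤ s) {f : Rn n → ℝ≥0∞}
    (hf : Measurable f) (x : Rn n) :
    (∫⁻ y, besselKernel α (x - y) * f y) ^ s ≤ ∫⁻ y, besselKernel α (x - y) * f y ^ s := by
  have hk : Measurable fun y : Rn n => besselKernel α (x - y) :=
    (measurable_besselKernel α).comp (measurable_const.sub measurable_id)
  -- The kernel has mass one, so ν is a probability measure and its L¹ norm is at most its L^s norm.
  let ν : Measure (Rn n) := volume.withDensity fun y => besselKernel α (x - y)
  have hν : IsProbabilityMeasure ν := ⟨by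
    rw [withDensity_apply _ MeasurableSet.univ, Measure.restrict_univ,
      lintegral_sub_left_eq_self (besselKernel α) x, lintegral_besselKernel hα]⟩
  have h := eLpNorm'_le_eLpNorm'_of_exponent_le one_pos hs ν hf.aestronglyMeasurable
  have e : ∀ g : Rn n → ℝ≥0∞, Measurable g →
      ∫⁻ y, g y ∂ν = ∫⁻ y, besselKernel α (x - y) * g y := fun g hg =>
    lintegral_withDensity_eq_lintegral_mul _ hk hg
  have hs0 : 0 < s := one_pos.trans_le hs
  simp only [eLpNorm', enorm_eq_self, ENNReal.rpow_one, div_one] at h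
  rw [e f hf, e _ (hf.pow_const s)] at h
  calc _ ≤ ((∫⁻ y, besselKernel α (x - y) * f y ^ s) ^ (1 / s)) ^ s := by gcongr
    _ = _ := by rw [← ENNReal.rpow_mul, one_div_mul_cancel hs0.ne', ENNReal.rpow_one]

/-- The Bessel capacity dominates Lebesgue measure. -/
lemma volume_le_capacity {n : ℕ} {α s : ℝ} (hα : 0 < α) (hs : 1 ≤ s) (E : Set (Rn n)) :
    volume E ≤ capacity α s E := by
  refine le_iInf₂ fun f ⟨hf, hfE⟩ => ?_
  have hs0 : 0 < s := one_pos.trans_le hs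
  have hk : Measurable fun z : Rn n × Rn n => besselKernel α (z.1 - z.2) * f z.2 ^ s :=
    ((measurable_besselKernel α).comp (measurable_fst.sub measurable_snd)).mul
      ((hf.comp measurable_snd).pow_const s)
  -- By Jensen the potential of f^s is also ≥ 1 on E. Chebyshev at level 1 bounds the volume by its
  -- integral, and Tonelli with the unit mass of the kernel reduces that integral to ∫ f^s.
  have h1 : volume E ≤ ∫⁻ x, (∫⁻ y, besselKernel α (x - y) * f y ^ s) := by
    have h2 : E ⊆ {x | 1 ≤ ∫⁻ y, besselKernel α (x - y) * f y ^ s} := fun x hx =>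
      (ENNReal.one_le_rpow (hfE x hx) hs0).trans (besselPotential_rpow_le hα hs hf x)
    have h3 := mul_meas_ge_le_lintegral (μ := volume) (hk.lintegral_prod_right' (ν := volume)) 1
    rw [one_mul] at h3
    exact (measure_mono h2).trans h3
  refine h1.trans (le_of_eq ?_)
  rw [lintegral_lintegral_swap hk.aemeasurable]
  refine lintegral_congr fun y => ?_
  have hy : Measurable fun x : Rn n => besselKernel α (x - y) :=
    (measurable_besselKernel α).comp (measurable_id.sub measurable_const)
  rw [lintegral_mul_const _ hy, lintegral_sub_right_eq_self (besselKernel α) y,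
    lintegral_besselKernel hα, one_mul]

/-- If E lies in the ball of radius R, a competitor is κ⁻¹ times the indicator of the ball of radius
R + 1, with κ the mass of the kernel on the unit ball: for x in E, the kernel centred at x keeps at
least the mass κ inside the larger ball. Strict positivity of the kernel makes κ nonzero. -/
lemma capacity_lt_top {n : ℕ} {α s : ℝ} (hα : 0 < α) (hs : 0 < s) {E : Set (Rn n)}
    (hE : Bornology.IsBounded E) : capacity α s E < ∞ := by
  obtain ⟨R, hR⟩ := hE.subset_ball 0
  set κ : ℝ≥0∞ := ∫⁻ z in Metric.ball (0 : Rn n) 1, besselKernel α z with hκ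
  have hκ0 : κ ≠ 0 := by
    refine ((setLIntegral_pos_iff (measurable_besselKernel α)).2 ?_).ne'
    have : Function.support (besselKernel α : Rn n → ℝ≥0∞) = univ :=
      eq_univ_of_forall fun x => (besselKernel_pos hα x).ne'
    rw [this, univ_inter]
    exact Metric.measure_ball_pos _ _ one_pos
  have hκt : κ ≠ ∞ := ((setLIntegral_le_lintegral _ _).trans_lt (by
    rw [lintegral_besselKernel hα]; simp)).ne
  have hm : Measurable ((Metric.ball (0 : Rn n) (R + 1)).indicator fun _ => κ⁻¹) :=
    measurable_const.indicator Metric.isOpen_ball.measurableSet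
  refine (capacity_le hm fun x hx => ?_).trans_lt ?_
  · have h1 : ∀ z, (Metric.ball (0 : Rn n) 1).indicator (besselKernel α) z * κ⁻¹ ≤
        besselKernel α z * (Metric.ball (0 : Rn n) (R + 1)).indicator (fun _ => κ⁻¹) (x - z) := by
      intro z
      by_cases hz : z ∈ Metric.ball (0 : Rn n) 1
      · have h2 : x - z ∈ Metric.ball (0 : Rn n) (R + 1) := by
          have h3 := hR hx
          rw [mem_ball_zero_iff] at hz h3 ⊢
          exact (norm_sub_le x z).trans_lt (by linarith)
        rw [indicator_of_mem hz, indicator_of_mem h2]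
      · simp [hz]
    have h4 := lintegral_sub_left_eq_self (μ := volume) (fun z : Rn n => besselKernel α z *
      (Metric.ball (0 : Rn n) (R + 1)).indicator (fun _ => κ⁻¹) (x - z)) x
    simp only [sub_sub_cancel] at h4
    rw [h4]
    refine le_trans (le_of_eq ?_) (lintegral_mono h1)
    rw [lintegral_mul_const' _ _ (ENNReal.inv_ne_top.2 hκ0),
      lintegral_indicator Metric.isOpen_ball.measurableSet, ← hκ, ENNReal.mul_inv_cancel hκ0 hκt]
  · have e : ∀ y, (Metric.ball (0 : Rn n) (R + 1)).indicator (fun _ => κ⁻¹) y ^ s =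
        (Metric.ball (0 : Rn n) (R + 1)).indicator (fun _ => κ⁻¹ ^ s) y := fun y => by
      by_cases hy : y ∈ Metric.ball (0 : Rn n) (R + 1)
      · rw [indicator_of_mem hy, indicator_of_mem hy]
      · rw [indicator_of_notMem hy, indicator_of_notMem hy, ENNReal.zero_rpow_of_pos hs]
    simp_rw [e]
    rw [lintegral_indicator Metric.isOpen_ball.measurableSet, setLIntegral_const]
    exact ENNReal.mul_lt_top (ENNReal.rpow_lt_top_of_nonneg hs.le (ENNReal.inv_ne_top.2 hκ0))
      Metric.isBounded_ball.measure_lt_top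

/-! ### Estimates for the capacitary Lorentz quasi-norm -/

lemma lorentzNorm_one_left {n : ℕ} (α s q : ℝ) (f : Rn n → ℝ) :
    lorentzNorm α s 1 q f = (∫⁻ t in Ioi (0 : ℝ),
      capacity α s {x | t < |f x|} ^ q * ENNReal.ofReal (t ^ q / t)) ^ (1 / q) := by
  simp [lorentzNorm]

lemma antitone_capacity_superlevel {n : ℕ} (α s : ℝ) (f : Rn n → ℝ) :
    Antitone fun t : ℝ => capacity α s {x | t < |f x|} := fun _ _ h =>
  capacity_mono α s fun _ hx => lt_of_le_of_lt h hx

lemma lintegral_rpow_div_self {q b : ℝ} (hq : 0 < q) (hb : 0 ≤ b) :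
    ∫⁻ t in Ioc (0 : ℝ) b, ENNReal.ofReal (t ^ q / t) = ENNReal.ofReal (b ^ q / q) := by
  have e : ∀ t ∈ Ioc (0 : ℝ) b, ENNReal.ofReal (t ^ q / t) = ENNReal.ofReal (t ^ (q - 1)) :=
    fun t ht => by rw [Real.rpow_sub_one ht.1.ne']
  have hi : IntegrableOn (fun t : ℝ => t ^ (q - 1)) (Ioc 0 b) :=
    (intervalIntegrable_iff_integrableOn_Ioc_of_le hb).1
      (intervalIntegral.intervalIntegrable_rpow' (by linarith))
  rw [setLIntegral_congr_fun measurableSet_Ioc e, ← ofReal_integral_eq_lintegral_ofReal hi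
    ((ae_restrict_mem measurableSet_Ioc).mono fun t ht => Real.rpow_nonneg ht.1.le _),
    ← intervalIntegral.integral_of_le hb, integral_rpow (.inl (by linarith)), sub_add_cancel,
    Real.zero_rpow hq.ne', sub_zero]

/-- The weak-type estimate. -/
lemma capacity_superlevel_mul_le {n : ℕ} (α s : ℝ) {q : ℝ} (hq : 0 < q) (hq1 : q ≤ 1)
    (f : Rn n → ℝ) {t : ℝ} (ht : 0 < t) :
    capacity α s {x | t < |f x|} * ENNReal.ofReal t ≤ lorentzNorm α s 1 q f := by
  rw [lorentzNorm_one_left, one_div, ENNReal.le_rpow_inv_iff hq, ENNReal.mul_rpow_of_nonneg _ _ hq.le,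
    ENNReal.ofReal_rpow_of_pos ht]
  have hm : Measurable fun t : ℝ => ENNReal.ofReal (t ^ q / t) := by fun_prop
  -- As q ≤ 1, t^q ≤ t^q / q = ∫₀ᵗ τ^{q-1} dτ; lower levels τ have larger superlevel sets. This
  -- gives the weak-type bound with constant one.
  calc _ ≤ capacity α s {x | t < |f x|} ^ q * ENNReal.ofReal (t ^ q / q) := by
        gcongr
        exact (le_div_iff₀ hq).2 (mul_le_of_le_one_right (by positivity) hq1)
    _ = ∫⁻ τ in Ioc (0 : ℝ) t,
          capacity α s {x | t < |f x|} ^ q * ENNReal.ofReal (τ ^ q / τ) := by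
        rw [lintegral_const_mul _ hm, lintegral_rpow_div_self hq ht.le]
    _ ≤ ∫⁻ τ in Ioc (0 : ℝ) t,
          capacity α s {x | τ < |f x|} ^ q * ENNReal.ofReal (τ ^ q / τ) := by
        refine setLIntegral_mono' measurableSet_Ioc fun τ hτ => ?_
        gcongr ?_ ^ q * _
        exact antitone_capacity_superlevel α s f hτ.2
    _ ≤ _ := lintegral_mono_set Ioc_subset_Ioi_self

/-- The embedding of `L^{1,q}(C)` into `L^{1,1}(C)` for `q ≤ 1`. -/
lemma lintegral_capacity_superlevel_le {n : ℕ} (α s : ℝ) {q : ℝ} (hq : 0 < q) (hq1 : q ≤ 1)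
    (f : Rn n → ℝ) :
    ∫⁻ t in Ioi (0 : ℝ), capacity α s {x | t < |f x|} ≤ lorentzNorm α s 1 q f := by
  rcases eq_or_ne (lorentzNorm α s 1 q f) ∞ with hN | hN
  · rw [hN]; exact le_top
  have hq' : 0 ≤ 1 - q := sub_nonneg.2 hq1
  -- Split C = C^{1-q} C^q and apply the weak-type bound to the first factor: (N/t)^{1-q} = N^{1-q}
  -- t^q/t produces exactly the weight of the quasi-norm. Integration then gives N^{1-q} N^q = N.
  have hpt : ∀ t ∈ Ioi (0 : ℝ), capacity α s {x | t < |f x|} ≤ lorentzNorm α s 1 q f ^ (1 - q) *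
      (capacity α s {x | t < |f x|} ^ q * ENNReal.ofReal (t ^ q / t)) := by
    intro t ht
    have ht : 0 < t := ht
    set d := capacity α s {x | t < |f x|}
    have h0 : ENNReal.ofReal t ≠ 0 := by simpa using ht
    have h1 : d ≤ lorentzNorm α s 1 q f * (ENNReal.ofReal t)⁻¹ := by
      rw [← div_eq_mul_inv, ENNReal.le_div_iff_mul_le (.inl h0) (.inl ENNReal.ofReal_ne_top)]
      exact capacity_superlevel_mul_le α s hq hq1 f ht
    have h2 : (ENNReal.ofReal t)⁻¹ ^ (1 - q) = ENNReal.ofReal (t ^ q / t) := by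
      rw [← ENNReal.ofReal_inv_of_pos ht, ENNReal.ofReal_rpow_of_pos (inv_pos.2 ht),
        Real.inv_rpow ht.le, ← Real.rpow_neg ht.le, neg_sub, Real.rpow_sub_one ht.ne']
    calc d = d ^ (1 - q) * d ^ q := by
          rw [← ENNReal.rpow_add_of_nonneg _ _ hq' hq.le, sub_add_cancel, ENNReal.rpow_one]
      _ ≤ (lorentzNorm α s 1 q f * (ENNReal.ofReal t)⁻¹) ^ (1 - q) * d ^ q := by gcongr
      _ = _ := by rw [ENNReal.mul_rpow_of_nonneg _ _ hq', h2]; ring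
  refine (setLIntegral_mono' measurableSet_Ioi hpt).trans (le_of_eq ?_)
  rw [lintegral_const_mul' _ _ (ENNReal.rpow_ne_top_of_nonneg hq' hN)]
  have h3 : ∫⁻ t in Ioi (0 : ℝ), capacity α s {x | t < |f x|} ^ q * ENNReal.ofReal (t ^ q / t) =
      lorentzNorm α s 1 q f ^ q := by
    rw [lorentzNorm_one_left, ← ENNReal.rpow_mul, one_div_mul_cancel hq.ne', ENNReal.rpow_one]
  rw [h3, ← ENNReal.rpow_add_of_nonneg _ _ hq' hq.le, sub_add_cancel, ENNReal.rpow_one]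

/-- The quasi-norm `q^{-1/q}` of the indicator function of a set of unit capacity. -/
noncomputable def indicatorConst (q : ℝ) : ℝ≥0 := ((1 / q) ^ (1 / q)).toNNReal

lemma indicatorConst_pos {q : ℝ} (hq : 0 < q) : 0 < indicatorConst q :=
  Real.toNNReal_pos.2 (by positivity)

/-- Comparison with b χ_E: the superlevel sets lie in E and are empty above b, so the defining
integral is at most C(E)^q ∫₀ᵇ t^{q-1} dt = C(E)^q b^q / q. -/
lemma lorentzNorm_le_of_support_subset {n : ℕ} (α : ℝ) {s q b : ℝ} (hs : 0 < s) (hq : 0 < q)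
    (hb : 0 ≤ b) {f : Rn n → ℝ} {E : Set (Rn n)} (hf : ∀ x, |f x| ≤ b)
    (hE : Function.support f ⊆ E) :
    lorentzNorm α s 1 q f ≤ indicatorConst q * ENNReal.ofReal b * capacity α s E := by
  have hm : Measurable fun t : ℝ => ENNReal.ofReal (t ^ q / t) := by fun_prop
  have h1 : ∫⁻ t in Ioi (0 : ℝ), capacity α s {x | t < |f x|} ^ q * ENNReal.ofReal (t ^ q / t) ≤
      capacity α s E ^ q * ENNReal.ofReal (b ^ q / q) := by
    rw [← lintegral_rpow_div_self hq hb, ← lintegral_const_mul _ hm,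
      ← lintegral_indicator measurableSet_Ioi, ← lintegral_indicator measurableSet_Ioc]
    refine lintegral_mono fun t => ?_
    by_cases ht : t ∈ Ioi (0 : ℝ)
    · have ht0 : 0 < t := ht
      rw [indicator_of_mem ht]
      by_cases htb : t ≤ b
      · rw [indicator_of_mem (show t ∈ Ioc 0 b from ⟨ht, htb⟩)]
        gcongr ?_ ^ q * _
        refine capacity_mono α s fun x hx => hE fun h0 => ?_
        rw [mem_ofPred_eq, h0, abs_zero] at hx
        exact hx.not_gt ht0
      · have : {x | t < |f x|} = ∅ :=
          eq_empty_of_forall_notMem fun x hx => htb ((le_of_lt hx).trans (hf x))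
        rw [this, capacity_empty hs, ENNReal.zero_rpow_of_pos hq, zero_mul]
        exact bot_le
    · rw [indicator_of_notMem ht]
      exact bot_le
  have h2 : ENNReal.ofReal (b ^ q / q) ^ (1 / q) = indicatorConst q * ENNReal.ofReal b := by
    rw [ENNReal.ofReal_rpow_of_nonneg (by positivity) (by positivity), div_eq_mul_one_div,
      Real.mul_rpow (by positivity) (by positivity), ← Real.rpow_mul hb, mul_one_div_cancel hq.ne',
      Real.rpow_one, ENNReal.ofReal_mul hb, mul_comm]
    rfl
  rw [lorentzNorm_one_left]
  calc _ ≤ (capacity α s E ^ q * ENNReal.ofReal (b ^ q / q)) ^ (1 / q) := by gcongr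
    _ = _ := by
      rw [ENNReal.mul_rpow_of_nonneg _ _ (by positivity), ← ENNReal.rpow_mul,
        mul_one_div_cancel hq.ne', ENNReal.rpow_one, h2, mul_comm]

lemma exists_abs_le {n : ℕ} (φ : C_c(Rn n, ℝ)) : ∃ b : ℝ, 0 ≤ b ∧ ∀ x, |φ x| ≤ b := by
  obtain ⟨b, hb⟩ := φ.hasCompactSupport.exists_bound_of_continuous φ.continuous
  exact ⟨b, (norm_nonneg _).trans (hb 0), hb⟩

lemma lorentzNorm_coe_lt_top {n : ℕ} {α s q : ℝ} (hα : 0 < α) (hs : 0 < s) (hq : 0 < q)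
    (φ : C_c(Rn n, ℝ)) : lorentzNorm α s 1 q φ < ∞ := by
  obtain ⟨b, hb0, hb⟩ := exists_abs_le φ
  refine (lorentzNorm_le_of_support_subset α hs hq hb0 hb (subset_tsupport _)).trans_lt ?_
  exact ENNReal.mul_lt_top (ENNReal.mul_lt_top ENNReal.coe_lt_top ENNReal.ofReal_lt_top)
    (capacity_lt_top hα hs φ.hasCompactSupport.isCompact.isBounded)

/-- The inclusion of `C_0` in `𝓛^{1,q}(C)`. -/
noncomputable def closureOfCc (n : ℕ) {α s q : ℝ} (hα : 0 < α) (hs : 0 < s) (hq : 0 < q) :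
    C_c(Rn n, ℝ) →ₗ[ℝ] lorentzClosure n α hs one_pos hq where
  toFun φ := ⟨φ, lorentzNorm_coe_lt_top hα hs hq φ, fun ε hε =>
    ⟨φ, by rwa [sub_self, lorentzNorm_zero hs one_pos hq]⟩⟩
  map_add' φ ψ := Subtype.ext (CompactlySupportedContinuousMap.coe_add φ ψ)
  map_smul' c φ := Subtype.ext (CompactlySupportedContinuousMap.coe_smul c φ)

/-! ### Continuous functionals on `𝓛^{1,q}(C)` -/

section Dual

variable {n : ℕ} {α s p q : ℝ} {hs : 0 < s} {hp : 0 < p} {hq : 0 < q}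

lemma opNorm_lt_top {L : lorentzClosure n α hs hp hq →ₗ[ℝ] ℝ}
    (hL : L ∈ lorentzDual n α hs hp hq) : opNorm (lorentzNorm α s p q) L < ∞ := by
  obtain ⟨δ, hδ, h⟩ := hL 0 1 one_pos
  -- δ may be infinite, so scaling uses a finite d strictly between 0 and δ.
  obtain ⟨d, hd0, hdδ⟩ := ENNReal.lt_iff_exists_nnreal_btwn.1 hδ
  have hd : (0 : ℝ) < d := by exact_mod_cast hd0
  refine lt_of_le_of_lt (b := ENNReal.ofReal (1 / d)) (iSup₂_le fun f hf => ?_)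
    ENNReal.ofReal_lt_top
  have h1 := h ((d : ℝ) • f) (by
    rw [ZeroMemClass.coe_zero, sub_zero, SetLike.val_smul, lorentzNorm_smul_of_pos hq hd]
    refine (mul_le_of_le_one_right bot_le hf).trans_lt ?_
    rwa [ENNReal.ofReal_coe_nnreal])
  rw [map_zero, sub_zero, map_smul, smul_eq_mul, abs_mul, abs_of_pos hd] at h1
  exact ENNReal.ofReal_le_ofReal ((le_div_iff₀' hd).2 h1.le)

lemma ofReal_abs_apply_le {L : lorentzClosure n α hs hp hq →ₗ[ℝ] ℝ} {B : ℝ≥0}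
    (hL : opNorm (lorentzNorm α s p q) L ≤ B) (f : lorentzClosure n α hs hp hq) :
    ENNReal.ofReal |L f| ≤ B * lorentzNorm α s p q (f : Rn n → ℝ) := by
  -- The quasi-norm of f may vanish, so f is normalised by any positive a above it; afterwards a
  -- decreases to the quasi-norm.
  have h1 : ∀ a : ℝ, 0 < a → lorentzNorm α s p q (f : Rn n → ℝ) ≤ ENNReal.ofReal a → |L f| ≤ B * a := by
    intro a ha hfa
    have h2 : lorentzNorm α s p q ((a⁻¹ • f : lorentzClosure n α hs hp hq) : Rn n → ℝ) ≤ 1 := by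
      rw [SetLike.val_smul, lorentzNorm_smul_of_pos hq (inv_pos.2 ha)]
      refine (mul_le_mul_right hfa _).trans (le_of_eq ?_)
      rw [← ENNReal.ofReal_mul (inv_pos.2 ha).le, inv_mul_cancel₀ ha.ne', ENNReal.ofReal_one]
    have h3 := (le_iSup₂ (f := fun (g : lorentzClosure n α hs hp hq)
      (_ : lorentzNorm α s p q (g : Rn n → ℝ) ≤ 1) => ENNReal.ofReal |L g|) _ h2).trans hL
    rw [map_smul, smul_eq_mul, abs_mul, abs_of_pos (inv_pos.2 ha), ← ENNReal.ofReal_coe_nnreal,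
      ENNReal.ofReal_le_ofReal_iff B.coe_nonneg, inv_mul_le_iff₀ ha, mul_comm] at h3
    exact h3
  have hf : lorentzNorm α s p q (f : Rn n → ℝ) ≠ ∞ := f.2.1.ne
  rw [← ENNReal.ofReal_toReal hf, ← ENNReal.ofReal_coe_nnreal, ← ENNReal.ofReal_mul B.coe_nonneg]
  refine ENNReal.ofReal_le_ofReal (le_of_forall_pos_le_add fun ε hε => ?_)
  have hB : (0 : ℝ) < B + 1 := by positivity
  have h4 := h1 ((lorentzNorm α s p q (f : Rn n → ℝ)).toReal + ε / (B + 1)) (by positivity) (by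
    rw [ENNReal.ofReal_add ENNReal.toReal_nonneg (by positivity), ENNReal.ofReal_toReal hf]
    exact le_self_add)
  have h5 : B * (ε / (B + 1)) ≤ ε := by
    rw [mul_div_assoc', div_le_iff₀ hB]
    nlinarith
  rw [mul_add] at h4
  linarith

lemma mem_lorentzDual_of_le {L : lorentzClosure n α hs hp hq →ₗ[ℝ] ℝ} {B : ℝ≥0}
    (hL : ∀ f, ENNReal.ofReal |L f| ≤ B * lorentzNorm α s p q (f : Rn n → ℝ)) :
    L ∈ lorentzDual n α hs hp hq := by
  intro f ε hε
  have hB : (0 : ℝ) < B + 1 := by positivity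
  refine ⟨ENNReal.ofReal (ε / (B + 1)), by simpa using div_pos hε hB, fun g hg => ?_⟩
  have h1 := hL (g - f)
  rw [map_sub] at h1
  have h2 : ENNReal.ofReal |L g - L f| ≤ ENNReal.ofReal (B * (ε / (B + 1))) := by
    rw [ENNReal.ofReal_mul B.coe_nonneg, ENNReal.ofReal_coe_nnreal]
    exact h1.trans (mul_le_mul_right hg.le _)
  rw [ENNReal.ofReal_le_ofReal_iff (by positivity)] at h2
  refine h2.trans_lt ?_
  rw [mul_div_assoc', div_lt_iff₀ hB]
  nlinarith

/-- A continuous functional on `𝓛^{1,q}(C)` is determined by its values on `C_0`. -/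
lemma lorentzDual_ext (hα : 0 < α) {L M : lorentzClosure n α hs one_pos hq →ₗ[ℝ] ℝ}
    (hL : L ∈ lorentzDual n α hs one_pos hq) (hM : M ∈ lorentzDual n α hs one_pos hq)
    (h : ∀ φ, L (closureOfCc n hα hs hq φ) = M (closureOfCc n hα hs hq φ)) : L = M := by
  -- L - M is continuous, hence bounded, and vanishes on C_0; its value at f is its value at f - φ,
  -- with quasi-norm as small as desired.
  have hD := opNorm_lt_top ((lorentzDual n α hs one_pos hq).sub_mem hL hM)
  have hB := ofReal_abs_apply_le (B := (opNorm (lorentzNorm α s 1 q) (L - M)).toNNReal)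
    (le_of_eq (ENNReal.coe_toNNReal hD.ne).symm)
  set B := (opNorm (lorentzNorm α s 1 q) (L - M)).toNNReal
  ext f
  rw [← sub_eq_zero, ← abs_nonpos_iff]
  refine le_of_forall_pos_le_add fun ε hε => ?_
  have hB1 : (0 : ℝ) < B + 1 := by positivity
  obtain ⟨φ, hφ⟩ := f.2.2 (ENNReal.ofReal (ε / (B + 1))) (by simpa using div_pos hε hB1)
  have h1 := hB (f - closureOfCc n hα hs hq φ)
  have h2 : (L - M) (f - closureOfCc n hα hs hq φ) = L f - M f := by
    simp only [map_sub, LinearMap.sub_apply, h φ]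
    ring
  rw [h2] at h1
  have h3 : ENNReal.ofReal |L f - M f| ≤ ENNReal.ofReal (B * (ε / (B + 1))) := by
    rw [ENNReal.ofReal_mul B.coe_nonneg, ENNReal.ofReal_coe_nnreal]
    exact h1.trans (mul_le_mul_right hφ.le _)
  rw [ENNReal.ofReal_le_ofReal_iff (by positivity)] at h3
  refine h3.trans ?_
  rw [zero_add, mul_div_assoc', div_le_iff₀ hB1]
  nlinarith

end Dual

variable {n : ℕ} {α s : ℝ}

/-! ### Measures dominated by the capacity -/

/-- Outer regularity reduces to open sets and inner regularity to compact K, where the measure is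
the infimum of Λ f over f ≥ 1 on K. -/
lemma rieszMeasure_apply_le {Λ₁ Λ₂ : C_c(Rn n, ℝ≥0) →ₗ[ℝ≥0] ℝ≥0} (h : ∀ φ, Λ₁ φ ≤ Λ₂ φ)
    (E : Set (Rn n)) : NNRealRMK.rieszMeasure Λ₁ E ≤ NNRealRMK.rieszMeasure Λ₂ E := by
  rw [Set.measure_eq_iInf_isOpen E (NNRealRMK.rieszMeasure Λ₂)]
  refine le_iInf fun G => le_iInf₂ fun hEG hG => (measure_mono hEG).trans ?_
  rw [hG.measure_eq_iSup_isCompact]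
  refine iSup_le fun K => iSup₂_le fun hKG hK => le_trans ?_ (measure_mono hKG)
  have e : ∀ Λ : C_c(Rn n, ℝ≥0) →ₗ[ℝ≥0] ℝ≥0, NNRealRMK.rieszMeasure Λ K
      = (rieszContentAux Λ ⟨K, hK⟩ : ℝ≥0) := fun Λ =>
    (rieszContent _).measure_eq_content_of_regular (contentRegular_rieszContent _) ⟨K, hK⟩
  rw [e, e, ENNReal.coe_le_coe]
  refine le_of_forall_pos_le_add fun ε hε => ?_
  obtain ⟨f, hf, hf'⟩ := exists_lt_rieszContentAux_add_pos Λ₂ ⟨K, hK⟩ hε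
  exact (rieszContentAux_le Λ₁ hf).trans ((h f).trans hf'.le)

lemma posMeasure_apply_le (μ : radonMeasures n) (E : Set (Rn n)) :
    posMeasure μ E ≤ totalVariation μ E := by
  refine rieszMeasure_apply_le (fun φ => NNReal.coe_le_coe.1 ?_) E
  change (variationFun μ φ + (μ : C_c(Rn n, ℝ) →ₗ[ℝ] ℝ) φ.toReal) / 2 ≤ variationFun μ φ
  have := (abs_le.1 (abs_toReal_le_variationFun μ φ)).2
  linarith

lemma totalVariation_neg (μ : radonMeasures n) : totalVariation (-μ) = totalVariation μ := by
  have : variationFunctional (-μ) = variationFunctional μ :=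
    LinearMap.ext fun φ => NNReal.eq (variationFun_neg μ φ)
  rw [totalVariation, totalVariation, this]

lemma posMeasure_le (μ : radonMeasures n) : posMeasure μ ≤ totalVariation μ :=
  Measure.le_iff'.2 (posMeasure_apply_le μ)

lemma negMeasure_le (μ : radonMeasures n) : negMeasure μ ≤ totalVariation μ :=
  (posMeasure_le (-μ)).trans_eq (totalVariation_neg μ)

/-- The factor 2 comes from bounding μ⁺ and μ⁻ separately by |μ|; it is harmless for an equivalence
of norms and spares the identity |μ| = μ⁺ + μ⁻. -/
lemma abs_signedIntegral_le (μ : radonMeasures n) (f : Rn n → ℝ) :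
    ENNReal.ofReal |signedIntegral μ f| ≤ 2 * ∫⁻ x, ‖f x‖ₑ ∂(totalVariation μ) := by
  have h : ∀ ν : Measure (Rn n), ν ≤ totalVariation μ →
      ENNReal.ofReal |∫ x, f x ∂ν| ≤ ∫⁻ x, ‖f x‖ₑ ∂(totalVariation μ) := fun ν hν => by
    rw [← Real.enorm_eq_ofReal_abs]
    exact (enorm_integral_le_lintegral_enorm f).trans (lintegral_mono' hν le_rfl)
  calc _ ≤ ENNReal.ofReal (|∫ x, f x ∂(posMeasure μ)| + |∫ x, f x ∂(negMeasure μ)|) :=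
        ENNReal.ofReal_le_ofReal (abs_sub _ _)
    _ ≤ _ := by
        rw [ENNReal.ofReal_add (abs_nonneg _) (abs_nonneg _), two_mul]
        exact add_le_add (h _ (posMeasure_le μ)) (h _ (negMeasure_le μ))

lemma signedIntegral_add (μ : radonMeasures n) {f g : Rn n → ℝ}
    (hf : Integrable f (totalVariation μ)) (hg : Integrable g (totalVariation μ)) :
    signedIntegral μ (f + g) = signedIntegral μ f + signedIntegral μ g := by
  rw [signedIntegral,
    integral_add' (hf.mono_measure (posMeasure_le μ)) (hg.mono_measure (posMeasure_le μ)),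
    integral_add' (hf.mono_measure (negMeasure_le μ)) (hg.mono_measure (negMeasure_le μ)),
    signedIntegral, signedIntegral]
  ring

lemma signedIntegral_smul (μ : radonMeasures n) (c : ℝ) (f : Rn n → ℝ) :
    signedIntegral μ (c • f) = c * signedIntegral μ f := by
  simp only [signedIntegral, Pi.smul_apply, smul_eq_mul, integral_const_mul]
  ring

/-- Domination of a measure by the capacity passes from open sets to arbitrary sets. -/
lemma measure_le_mul_capacity_of_isOpen (hs : 0 < s) {ν : Measure (Rn n)} {a : ℝ≥0} (ha : 0 < a)
    (h : ∀ U, IsOpen U → ν U ≤ a * capacity α s U) (E : Set (Rn n)) :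
    ν E ≤ a * capacity α s E := by
  have ha0 : (a : ℝ≥0∞) ≠ 0 := by simpa using ha.ne'
  rw [mul_comm, ← ENNReal.div_le_iff_le_mul (.inl ha0) (.inl ENNReal.coe_ne_top)]
  -- Every c above C(E) is above C(U) for some open U containing E.
  refine le_of_forall_gt_imp_ge_of_dense fun c hc => ?_
  obtain ⟨U, hEU, hU, hUc⟩ := exists_isOpen_capacity_lt hs hc
  rw [ENNReal.div_le_iff_le_mul (.inl ha0) (.inl ENNReal.coe_ne_top), mul_comm]
  exact (measure_mono hEU).trans ((h U hU).trans (mul_le_mul_right hUc.le _))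

/-- The trace norm says nothing about compact sets of zero capacity. Inside an open U, a nonempty
compact K is therefore enlarged to a compact K' with nonempty interior, whose capacity is positive
because it dominates Lebesgue measure. -/
lemma totalVariation_le_of_traceNorm_le (hα : 0 < α) (hs : 1 ≤ s) {μ : radonMeasures n} {a : ℝ≥0}
    (ha : 0 < a) (h : traceNorm α s μ ≤ a) (E : Set (Rn n)) :
    totalVariation μ E ≤ a * capacity α s E := by
  have hs0 : 0 < s := one_pos.trans_le hs
  refine measure_le_mul_capacity_of_isOpen hs0 ha (fun U hU => ?_) E
  rw [totalVariation, hU.measure_eq_iSup_isCompact, ← totalVariation]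
  refine iSup_le fun K => iSup₂_le fun hKU hK => ?_
  obtain ⟨K', hK', hKK', hK'U⟩ := exists_compact_between hK hU hKU
  rcases K.eq_empty_or_nonempty with rfl | hne
  · simp
  have h0 : capacity α s K' ≠ 0 := by
    refine ne_of_gt (lt_of_lt_of_le ?_ (volume_le_capacity hα hs K'))
    exact (isOpen_interior.measure_pos _ (hne.mono hKK')).trans_le (measure_mono interior_subset)
  have h2 : totalVariation μ K' / capacity α s K' ≤ traceNorm α s μ :=
    le_iSup_of_le K' (le_iSup₂_of_le hK' h0 le_rfl)
  have h1 := h2.trans h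
  rw [ENNReal.div_le_iff_le_mul (.inl h0) (.inl (capacity_lt_top hα hs0 hK'.isBounded).ne)] at h1
  calc _ ≤ totalVariation μ K' := measure_mono (hKK'.trans interior_subset)
    _ ≤ _ := h1.trans (mul_le_mul_right (capacity_mono α s hK'U) _)

lemma traceNorm_le_of_totalVariation_le {μ : radonMeasures n} {a : ℝ≥0∞}
    (h : ∀ E, totalVariation μ E ≤ a * capacity α s E) : traceNorm α s μ ≤ a :=
  iSup_le fun K => iSup₂_le fun _ _ => ENNReal.div_le_of_le_mul (h K)

theorem traceNorm_eq_iInf (hα : 0 < α) (hs : 1 ≤ s) (μ : radonMeasures n) :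
    traceNorm α s μ = ⨅ (a : ℝ≥0) (_ : 0 < a ∧
      ∀ E : Set (Rn n), totalVariation μ E ≤ (a : ℝ≥0∞) * capacity α s E), (a : ℝ≥0∞) := by
  refine le_antisymm (le_iInf₂ fun a ha => traceNorm_le_of_totalVariation_le ha.2) ?_
  -- Every positive finite a above the norm is admissible; if the norm is ∞ there is nothing to
  -- show.
  refine le_of_forall_gt_imp_ge_of_dense fun c hc => ?_
  obtain ⟨a, ha, hac⟩ := ENNReal.lt_iff_exists_nnreal_btwn.1 hc
  have ha0 : 0 < a := ENNReal.coe_pos.1 (bot_le.trans_lt ha)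
  exact (iInf₂_le a ⟨ha0, totalVariation_le_of_traceNorm_le hα hs ha0 ha.le⟩).trans hac.le

/-- A functional on `C_0` bounded for the Lorentz quasi-norm is dominated by the capacity. -/
lemma totalVariation_le_of_apply_le {q : ℝ} (hs : 0 < s) (hq : 0 < q)
    {μ : radonMeasures n} {B : ℝ≥0} (hB : 0 < B)
    (h : ∀ ψ : C_c(Rn n, ℝ), ENNReal.ofReal |(μ : C_c(Rn n, ℝ) →ₗ[ℝ] ℝ) ψ| ≤
      B * lorentzNorm α s 1 q ψ) (E : Set (Rn n)) :
    totalVariation μ E ≤ (B * indicatorConst q : ℝ≥0) * capacity α s E := by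
  have hc := mul_pos hB (indicatorConst_pos hq)
  refine measure_le_mul_capacity_of_isOpen hs hc (fun U hU => ?_) E
  rcases eq_or_ne (capacity α s U) ∞ with hU' | hU'
  · rw [hU', ENNReal.mul_top (by simpa using hc.ne')]
    exact le_top
  -- |μ|(U) is at most the supremum of |μ|(φ) over φ ≤ χ_U. Each ψ with |ψ| ≤ φ is bounded by 1 and
  -- vanishes off U, so it is controlled by C(U).
  rw [totalVariation_apply]
  refine iInf_le_of_le U (iInf₂_le_of_le le_rfl hU (iSup₂_le fun φ hφ => ?_))
  refine ENNReal.ofReal_le_of_le_toReal (variationFun_le μ fun ψ hψ => ?_)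
  have hφ1 : ∀ x, φ x ≤ 1 := fun x => (hφ x).trans (indicator_le_self' (by simp) x)
  have h1 : ∀ x, |ψ x| ≤ 1 := fun x => (hψ x).trans (by exact_mod_cast hφ1 x)
  have h2 : Function.support ψ ⊆ U := fun x hx => by
    by_contra hxU
    have h3 := hφ x
    rw [indicator_of_notMem hxU] at h3
    have h4 := hψ x
    rw [le_antisymm h3 bot_le] at h4
    exact hx (by simpa using h4)
  have h3 := (h ψ).trans
    (mul_le_mul_right (lorentzNorm_le_of_support_subset α hs hq zero_le_one h1 h2) _)
  rw [ENNReal.ofReal_one, mul_one, ← mul_assoc, ← ENNReal.coe_mul] at h3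
  exact (le_abs_self _).trans
    ((ENNReal.ofReal_le_iff_le_toReal (ENNReal.mul_ne_top ENNReal.coe_ne_top hU')).1 h3)

/-! ### Integrability of the functions in 𝓛^{1,q}(C). -/

section Integral

variable {q : ℝ} {hs : 0 < s} {hq : 0 < q} {ν : Measure (Rn n)} {a : ℝ≥0}

/-- Members of the closure are arbitrary functions, so measurability must be proved. Approximants
from C_0 converge in capacity by the weak-type bound, hence in ν-measure, and a subsequence
converges ν-almost everywhere. -/
lemma aemeasurable_of_mem_lorentzClosure (hq1 : q ≤ 1) (h : ∀ E, ν E ≤ a * capacity α s E)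
    (f : lorentzClosure n α hs one_pos hq) : AEMeasurable (f : Rn n → ℝ) ν := by
  choose φ hφ using fun k : ℕ => f.2.2 ((k : ℝ≥0∞) + 1)⁻¹ (by simp)
  have hlim : TendstoInMeasure ν (fun k => (φ k : Rn n → ℝ)) atTop f := by
    refine tendstoInMeasure_iff_norm.2 fun ε hε => ?_
    have hε0 : ENNReal.ofReal (ε / 2) ≠ 0 := by simpa using hε
    have hle : ∀ k, ν {x | ε ≤ ‖φ k x - (f : Rn n → ℝ) x‖} ≤
        a * ((ENNReal.ofReal (ε / 2))⁻¹ * ((k : ℝ≥0∞) + 1)⁻¹) := by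
      intro k
      -- Convergence in measure is stated with ε ≤ |·| and the superlevel sets are strict, hence the
      -- level ε/2.
      have h1 := capacity_superlevel_mul_le α s hq hq1 ((f : Rn n → ℝ) - ⇑(φ k)) (half_pos hε)
      rw [← ENNReal.le_div_iff_mul_le (.inl hε0) (.inl ENNReal.ofReal_ne_top),
        ENNReal.div_eq_inv_mul] at h1
      refine (h _).trans (mul_le_mul_right (le_trans ?_
        (h1.trans (mul_le_mul_right (hφ k).le _))) _)
      refine capacity_mono α s fun x hx => ?_
      rw [mem_ofPred_eq, Real.norm_eq_abs, abs_sub_comm] at hx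
      exact (half_lt_self hε).trans_le hx
    have hk : Tendsto (fun k : ℕ => ((k : ℝ≥0∞) + 1)⁻¹) atTop (𝓝 0) := by
      have := (tendsto_add_atTop_iff_nat 1).2 ENNReal.tendsto_inv_nat_nhds_zero
      simpa using this
    have h2 := ENNReal.Tendsto.const_mul (a := (a : ℝ≥0∞)) (ENNReal.Tendsto.const_mul
      (a := (ENNReal.ofReal (ε / 2))⁻¹) hk (.inr (ENNReal.inv_ne_top.2 hε0)))
      (.inr ENNReal.coe_ne_top)
    rw [mul_zero, mul_zero] at h2
    exact tendsto_of_tendsto_of_tendsto_of_le_of_le tendsto_const_nhds h2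
      (fun _ => bot_le) hle
  obtain ⟨ns, -, hns⟩ := hlim.exists_seq_tendsto_ae
  exact aemeasurable_of_tendsto_metrizable_ae' (fun k => (φ (ns k)).continuous.aemeasurable) hns

/-- Layer-cake formula, domination by the capacity on each superlevel set, and the embedding into
L^{1,1}(C). -/
lemma lintegral_enorm_le_mul_lorentzNorm (hq1 : q ≤ 1) (h : ∀ E, ν E ≤ a * capacity α s E)
    (f : lorentzClosure n α hs one_pos hq) :
    ∫⁻ x, ‖(f : Rn n → ℝ) x‖ₑ ∂ν ≤ a * lorentzNorm α s 1 q (f : Rn n → ℝ) := by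
  have hm : AEMeasurable (fun x => |(f : Rn n → ℝ) x|) ν :=
    (aemeasurable_of_mem_lorentzClosure hq1 h f).norm
  simp_rw [Real.enorm_eq_ofReal_abs]
  rw [lintegral_eq_lintegral_meas_lt ν (.of_forall fun x => abs_nonneg _) hm]
  calc _ ≤ ∫⁻ t in Ioi (0 : ℝ), a * capacity α s {x | t < |(f : Rn n → ℝ) x|} :=
        lintegral_mono fun t => h _
    _ = a * ∫⁻ t in Ioi (0 : ℝ), capacity α s {x | t < |(f : Rn n → ℝ) x|} :=
        lintegral_const_mul' _ _ ENNReal.coe_ne_top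
    _ ≤ _ := mul_le_mul_right (lintegral_capacity_superlevel_le α s hq hq1 _) _

lemma integrable_of_mem_lorentzClosure (hq1 : q ≤ 1) (h : ∀ E, ν E ≤ a * capacity α s E)
    (f : lorentzClosure n α hs one_pos hq) : Integrable (f : Rn n → ℝ) ν :=
  ⟨(aemeasurable_of_mem_lorentzClosure hq1 h f).aestronglyMeasurable,
    (lintegral_enorm_le_mul_lorentzNorm hq1 h f).trans_lt
      (ENNReal.mul_lt_top ENNReal.coe_lt_top f.2.1)⟩

end Integral

/-! ### The duality -/

section Duality

variable {q : ℝ}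

lemma exists_totalVariation_le (hα : 0 < α) (hs : 1 ≤ s) (μ : traceMeasures n α s) :
    ∃ a : ℝ≥0, ∀ E, totalVariation (μ : radonMeasures n) E ≤ a * capacity α s E := by
  obtain ⟨a, ha, -⟩ := ENNReal.lt_iff_exists_nnreal_btwn.1 (show traceNorm α s _ < ∞ from μ.2)
  have ha0 : 0 < a := ENNReal.coe_pos.1 (bot_le.trans_lt ha)
  exact ⟨a, totalVariation_le_of_traceNorm_le hα hs ha0 ha.le⟩

lemma integrable_totalVariation (hα : 0 < α) (hs : 1 < s) (hq : 0 < q) (hq1 : q ≤ 1)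
    (μ : traceMeasures n α s) (f : lorentzClosure n α (one_pos.trans hs) one_pos hq) :
    Integrable (f : Rn n → ℝ) (totalVariation (μ : radonMeasures n)) := by
  obtain ⟨a, ha⟩ := exists_totalVariation_le hα hs.le μ
  exact integrable_of_mem_lorentzClosure hq1 ha f

/-- The functional `L_μ(f) = ∫ f dμ` on `𝓛^{1,q}(C)`. -/
noncomputable def integralFunctional (hα : 0 < α) (hs : 1 < s) (hq : 0 < q) (hq1 : q ≤ 1)
    (μ : traceMeasures n α s) : lorentzClosure n α (one_pos.trans hs) one_pos hq →ₗ[ℝ] ℝ where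
  toFun f := signedIntegral (μ : radonMeasures n) f
  map_add' f g := signedIntegral_add _ (integrable_totalVariation hα hs hq hq1 μ f)
    (integrable_totalVariation hα hs hq hq1 μ g)
  map_smul' c f := signedIntegral_smul (μ : radonMeasures n) c (f : Rn n → ℝ)

lemma ofReal_abs_integralFunctional_le (hα : 0 < α) (hs : 1 < s) (hq : 0 < q) (hq1 : q ≤ 1)
    (μ : traceMeasures n α s) {a : ℝ≥0}
    (ha : ∀ E, totalVariation (μ : radonMeasures n) E ≤ a * capacity α s E)
    (f : lorentzClosure n α (one_pos.trans hs) one_pos hq) :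
    ENNReal.ofReal |integralFunctional hα hs hq hq1 μ f| ≤
      (2 * a : ℝ≥0) * lorentzNorm α s 1 q (f : Rn n → ℝ) := by
  refine (abs_signedIntegral_le (μ : radonMeasures n) (f : Rn n → ℝ)).trans ?_
  rw [ENNReal.coe_mul, mul_assoc]
  exact mul_le_mul_right (lintegral_enorm_le_mul_lorentzNorm hq1 ha f) _

lemma integralFunctional_mem (hα : 0 < α) (hs : 1 < s) (hq : 0 < q) (hq1 : q ≤ 1)
    (μ : traceMeasures n α s) :
    integralFunctional hα hs hq hq1 μ ∈ lorentzDual n α (one_pos.trans hs) one_pos hq := by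
  obtain ⟨a, ha⟩ := exists_totalVariation_le hα hs.le μ
  exact mem_lorentzDual_of_le (ofReal_abs_integralFunctional_le hα hs hq hq1 μ ha)

lemma integralFunctional_closureOfCc (hα : 0 < α) (hs : 1 < s) (hq : 0 < q) (hq1 : q ≤ 1)
    (μ : traceMeasures n α s) (φ : C_c(Rn n, ℝ)) :
    integralFunctional hα hs hq hq1 μ (closureOfCc n hα (one_pos.trans hs) hq φ) =
      ((μ : radonMeasures n) : C_c(Rn n, ℝ) →ₗ[ℝ] ℝ) φ :=
  signedIntegral_coe (μ : radonMeasures n) φ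

/-- The map `μ ↦ L_μ` from `𝔐` to the dual of `𝓛^{1,q}(C)`. -/
noncomputable def integralMap (n : ℕ) (hα : 0 < α) (hs : 1 < s) (hq : 0 < q) (hq1 : q ≤ 1) :
    traceMeasures n α s →ₗ[ℝ] lorentzDual n α (one_pos.trans hs) one_pos hq where
  toFun μ := ⟨integralFunctional hα hs hq hq1 μ, integralFunctional_mem hα hs hq hq1 μ⟩
  -- μ ↦ μ⁺ is not additive, so linearity in μ is checked on C_0, where L_μ is μ itself, and
  -- extended by density.
  map_add' μ ν := Subtype.ext <| lorentzDual_ext hα (integralFunctional_mem hα hs hq hq1 _)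
    (Submodule.add_mem _ (integralFunctional_mem hα hs hq hq1 μ)
      (integralFunctional_mem hα hs hq hq1 ν)) fun φ => by
    simp only [LinearMap.add_apply, integralFunctional_closureOfCc, Submodule.coe_add]
  map_smul' c μ := Subtype.ext <| lorentzDual_ext hα (integralFunctional_mem hα hs hq hq1 _)
    (Submodule.smul_mem _ c (integralFunctional_mem hα hs hq hq1 μ)) fun φ => by
    simp only [LinearMap.smul_apply, integralFunctional_closureOfCc, SetLike.val_smul,
      RingHom.id_apply]

lemma integralMap_injective (hα : 0 < α) (hs : 1 < s) (hq : 0 < q) (hq1 : q ≤ 1) :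
    Function.Injective (integralMap n hα hs hq hq1) := by
  intro μ ν h
  refine Subtype.ext (Subtype.ext (LinearMap.ext fun φ => ?_))
  rw [← integralFunctional_closureOfCc hα hs hq hq1, ← integralFunctional_closureOfCc hα hs hq hq1]
  exact LinearMap.congr_fun (congrArg Subtype.val h) _

/-- A function supported in K and bounded by b has quasi-norm at most a constant times b C(K), and
C(K) is finite. -/
lemma restrict_mem_radonMeasures (hα : 0 < α) {hs : 0 < s} {hq : 0 < q}
    {L : lorentzClosure n α hs one_pos hq →ₗ[ℝ] ℝ} {B : ℝ≥0}
    (h : ∀ f, ENNReal.ofReal |L f| ≤ B * lorentzNorm α s 1 q (f : Rn n → ℝ)) :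
    L ∘ₗ closureOfCc n hα hs hq ∈ radonMeasures n := by
  intro K hK
  have hKt := (capacity_lt_top (α := α) hα hs hK.isBounded).ne
  refine ⟨B * indicatorConst q * (capacity α s K).toReal, by positivity, fun φ hφ b hb => ?_⟩
  have hb0 : 0 ≤ b := (abs_nonneg _).trans (hb 0)
  have h1 := (h (closureOfCc n hα hs hq φ)).trans (mul_le_mul_right
    (lorentzNorm_le_of_support_subset α hs hq hb0 hb ((subset_tsupport _).trans hφ)) _)
  rw [ENNReal.ofReal_le_iff_le_toReal (by finiteness)] at h1
  refine h1.trans (le_of_eq ?_)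
  simp only [ENNReal.toReal_mul, ENNReal.coe_toReal, ENNReal.toReal_ofReal hb0]
  ring

/-- The preimage of L is its restriction to C_0: boundedness of L puts it in 𝔐, and density gives
equality. -/
lemma integralMap_surjective (hα : 0 < α) (hs : 1 < s) (hq : 0 < q) (hq1 : q ≤ 1) :
    Function.Surjective (integralMap n hα hs hq hq1) := by
  intro L
  -- B is taken strictly above the operator norm so that it is positive even for L = 0.
  obtain ⟨B, hB, -⟩ := ENNReal.lt_iff_exists_nnreal_btwn.1 (opNorm_lt_top L.2)
  have hB0 : 0 < B := ENNReal.coe_pos.1 (bot_le.trans_lt hB)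
  have hL := ofReal_abs_apply_le hB.le
  let μ : radonMeasures n := ⟨_, restrict_mem_radonMeasures hα hL⟩
  have hμ : traceNorm α s μ < ∞ := (traceNorm_le_of_totalVariation_le
    (totalVariation_le_of_apply_le (one_pos.trans hs) hq hB0 fun ψ =>
      hL (closureOfCc n hα _ hq ψ))).trans_lt ENNReal.coe_lt_top
  refine ⟨⟨μ, hμ⟩, Subtype.ext (lorentzDual_ext hα (integralFunctional_mem hα hs hq hq1 _) L.2
    fun φ => ?_)⟩
  exact integralFunctional_closureOfCc hα hs hq hq1 _ φ

lemma opNorm_integralFunctional_le (hα : 0 < α) (hs : 1 < s) (hq : 0 < q) (hq1 : q ≤ 1)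
    (μ : traceMeasures n α s) :
    opNorm (lorentzNorm α s 1 q) (integralFunctional hα hs hq hq1 μ) ≤
      2 * traceNorm α s (μ : radonMeasures n) := by
  rw [mul_comm, ← ENNReal.div_le_iff_le_mul (by simp) (by simp)]
  refine le_of_forall_gt_imp_ge_of_dense fun c hc => ?_
  obtain ⟨a, ha, hac⟩ := ENNReal.lt_iff_exists_nnreal_btwn.1 hc
  have ha0 : 0 < a := ENNReal.coe_pos.1 (bot_le.trans_lt ha)
  refine le_trans ?_ hac.le
  rw [ENNReal.div_le_iff_le_mul (by simp) (by simp), mul_comm]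
  refine iSup₂_le fun f hf => ?_
  have h := ofReal_abs_integralFunctional_le hα hs hq hq1 μ
    (totalVariation_le_of_traceNorm_le hα hs.le ha0 ha.le) f
  rw [ENNReal.coe_mul] at h
  exact h.trans (mul_le_of_le_one_right bot_le hf)

/-- On C_0 the functional is μ, so its norm controls |μ| on open sets; the constant is the q^{-1/q}
of an indicator function. -/
lemma traceNorm_le_opNorm_integralFunctional (hα : 0 < α) (hs : 1 < s) (hq : 0 < q) (hq1 : q ≤ 1)
    (μ : traceMeasures n α s) :
    traceNorm α s (μ : radonMeasures n) ≤
      indicatorConst q * opNorm (lorentzNorm α s 1 q) (integralFunctional hα hs hq hq1 μ) := by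
  have hk : (indicatorConst q : ℝ≥0∞) ≠ 0 := by simpa using (indicatorConst_pos hq).ne'
  rw [mul_comm, ← ENNReal.div_le_iff_le_mul (.inl hk) (.inl ENNReal.coe_ne_top)]
  refine le_of_forall_gt_imp_ge_of_dense fun c hc => ?_
  obtain ⟨B, hB, hBc⟩ := ENNReal.lt_iff_exists_nnreal_btwn.1 hc
  have hB0 : 0 < B := ENNReal.coe_pos.1 (bot_le.trans_lt hB)
  refine le_trans ?_ hBc.le
  rw [ENNReal.div_le_iff_le_mul (.inl hk) (.inl ENNReal.coe_ne_top), ← ENNReal.coe_mul]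
  refine traceNorm_le_of_totalVariation_le
    (totalVariation_le_of_apply_le (one_pos.trans hs) hq hB0 fun ψ => ?_)
  rw [← integralFunctional_closureOfCc hα hs hq hq1]
  exact ofReal_abs_apply_le hB.le _

end Duality

end CapacitaryLorentz

theorem theorem1p9 {n : ℕ} {α s q : ℝ} (hα : 0 < α) (hs : 1 < s) (hsn : s ≤ (n : ℝ) / α)
    (hq : 0 < q) (hq1 : q ≤ 1) :
    (∃ Φ : traceMeasures n α s ≃ₗ[ℝ] lorentzDual n α (one_pos.trans hs) one_pos hq,
      (∀ (μ : traceMeasures n α s) (f : lorentzClosure n α (one_pos.trans hs) one_pos hq),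
        Integrable (f : Rn n → ℝ) (totalVariation (μ : radonMeasures n)) ∧
          (Φ μ).1 f = signedIntegral (μ : radonMeasures n) f) ∧
      ∃ c : ℝ≥0, 0 < c ∧ ∀ μ : traceMeasures n α s,
        (c : ℝ≥0∞)⁻¹ * traceNorm α s (μ : radonMeasures n) ≤
          opNorm (lorentzNorm α s 1 q) (Φ μ).1 ∧
        opNorm (lorentzNorm α s 1 q) (Φ μ).1 ≤
          (c : ℝ≥0∞) * traceNorm α s (μ : radonMeasures n)) ∧
    ∀ μ : radonMeasures n,
      traceNorm α s μ =
        ⨅ (a : ℝ≥0) (_ : 0 < a ∧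
          ∀ E : Set (Rn n), totalVariation μ E ≤ (a : ℝ≥0∞) * capacity α s E), (a : ℝ≥0∞) := by
  refine ⟨⟨LinearEquiv.ofBijective (integralMap n hα hs hq hq1)
    ⟨integralMap_injective hα hs hq hq1, integralMap_surjective hα hs hq hq1⟩,
    fun μ f => ⟨integrable_totalVariation hα hs hq hq1 μ f, rfl⟩,
    -- The 2 serves the upper bound (μ⁺ and μ⁻), the other constant the lower bound.
    max 2 (indicatorConst q), by positivity, fun μ => ⟨?_, ?_⟩⟩, traceNorm_eq_iInf hα hs.le⟩
  · rw [ENNReal.inv_mul_le_iff (by simp) ENNReal.coe_ne_top]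
    refine (traceNorm_le_opNorm_integralFunctional hα hs hq hq1 μ).trans ?_
    exact mul_le_mul_left (ENNReal.coe_le_coe.2 (le_max_right _ _)) _
  · refine (opNorm_integralFunctional_le hα hs hq hq1 μ).trans ?_
    exact mul_le_mul_left (ENNReal.coe_le_coe.2 (le_max_left 2 _)) _
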